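/- Let $\mathbb K=\mathbb R$ or $\mathbb C$ and $R=\mathbb K[x,y]$. For a finite connected directed graph $G=(V,E)$ (the edge $e$ running from $\mathrm{tail}(e)$ to $\mathrm{head}(e)$) and an edge-labeling $\ell\colon E\to R$, a *spline* on $(G,\ell)$ is a map $p\colon V\to R$ such that $\ell(e)$ divides $p(\mathrm{head}(e))-p(\mathrm{tail}(e))$ for each edge $e$. Let $\mathsf{Spl}_{\le d}(G,\ell)$ be the $\mathbb K$-vector space of splines all of whose values have degree at most $d$. For $v_0\in V$ let $\mathsf{Spl}_{\le d}(G,\ell;v_0)$ be the subspace $\{p(v_0)=0\}$, a complement of the constant splines. Let $\mathsf{Spl}_2(G,\ell;v_0)$ be the space of splines that vanish at $v_0$ and all of whose values are zero or homogeneous of degree $2$. If no label is zero, let $\varphi_\ell(p)\in R^E$ be given by $p(\mathrm{head}(e))-p(\mathrm{tail}(e))=\varphi_\ell(p)(e)\,\ell(e)$. Let $G$ be embedded in the plane. A labeling $\ell'$ is *face-translatable* if for the cycle around each bounded face there is a point $(x_0,y_0)\in\mathbb K^2$ at which all labels on that cycle vanish. **Theorem.** Let $G$ be a finite connected directed plane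 graph and $\ell'(e)=(a_ex+b_ey+c_e)^2$, with $(a_e,b_e)\ne(0,0)$ for each edge $e$, a face-translatable labeling with homogenization $\ell(e)=(a_ex+b_ey)^2$. 1. $\varphi_{\ell'}$ maps $\mathsf{Spl}_{\le2}(G,\ell')$ onto $\ker M^{\mathsf{ext}}\subseteq\mathbb K^E$. Here $M^{\mathsf{ext}}$ has, for each bounded face $F$, three rows with entries $\varepsilon_{F,e}a_e^2,\ \varepsilon_{F,e}a_eb_e,\ \varepsilon_{F,e}b_e^2$ in column $e$, where $\varepsilon_{F,e}$ is $1$ or $-1$ if $e$ lies on the cycle around $F$ and points clockwise, respectively counterclockwise, and $0$ if $e$ is not on that cycle. 2. For each vertex $v_0$ there is an isomorphism of vector spaces $\Psi\colon\mathsf{Spl}_{\le2}(G,\ell';v_0)\to\mathsf{Spl}_2(G,\ell;v_0)$ with $\varphi_\ell\circ\Psi=\varphi_{\ell'}$, and $\mathsf{Spl}_{\le2}(G,\ell;v_0)=\mathsf{Spl}_2(G,\ell;v_0)$. Moreover $\mathsf{Spl}_{\le2}(G,\ell')\cong\mathsf{Spl}_{\le2}(G,\ell)$ as vector spaces. 3.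 There are $x_0,y_0\in\mathbb K$ such that $\tau\colon x\mapsto x_0x-y_0y,\ y\mapsto y_0x+x_0y$ defines an automorphism of the $\mathbb K$-algebra $R$, and scalars $u_e\ne0$, $m_e$, $s_e$ with $\tau(\ell'(e))=u_e(x+m_ey+s_e)^2$ and $\tau(\ell(e))=u_e(x+m_ey)^2$ for each $e$. The labeling $e\mapsto(x+m_ey+s_e)^2$ is again face-translatable, and for each $d$, $p\mapsto\tau\circ p$ identifies $\mathsf{Spl}_{\le d}(G,\ell')$ and $\mathsf{Spl}_{\le d}(G,\ell)$ with the spaces of splines of degree at most $d$ for the labelings $(x+m_ey+s_e)^2$ and $(x+m_ey)^2$, respectively. In particular, let $\Delta$ be a planar triangulation: a finite non-empty simplicial complex in $\mathbb R^2$ in which each simplex is a face of a triangle, any two triangles are joined by a chain of triangles in which consecutive ones share an edge, and the region covered has connected complement (no holes). Let $G_\Delta$ be its dual graph, with one vertex for each triangle and one edge (directed arbitrarily) for each pair of triangles sharing an edge, and label each edge by $\ell'(e)=(a_ex+b_ey+c_e)^2$, where $(a_e,b_e)\neq(0,0)$ and the shared edge lies on the line $a_ex+b_ey+c_e=0$;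 let $\ell(e)=(a_ex+b_ey)^2$. Then the conclusions of part 2 hold for $(G_\Delta,\ell')$ and $(G_\Delta,\ell)$. -/

import Mathlib

open MvPolynomial

/-- A directed graph (loops and parallel edges allowed) with vertex set `V` and edge set `E`. -/
structure DirGraph (V E : Type*) where
  tail : E → V
  head : E → V

namespace DirGraph

variable {V E : Type*} (G : DirGraph V E)

/-- Connectedness of the underlying undirected graph. -/
def IsConnected : Prop :=
  Nonempty V ∧ ∀ u v : V, Relation.EqvGen (fun u v => ∃ e, G.tail e = u ∧ G.head e = v) u v

/-- Every edge `e` carries two darts (half-edges): `(e, true)` runs from the tail of `e` to its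
head, and `(e, false)` runs from the head of `e` to its tail. `G.src d` is the start of `d`. -/
def src (d : E × Bool) : V := if d.2 then G.tail d.1 else G.head d.1

end DirGraph

/-- The same edge, traversed in the opposite direction. -/
def dartRev {E : Type*} : Equiv.Perm (E × Bool) where
  toFun d := (d.1, !d.2)
  invFun d := (d.1, !d.2)
  left_inv d := by simp
  right_inv d := by simp

/-- A finite connected directed graph drawn in the plane without crossings, described by its
combinatorial embedding (rotation system): `rot` sends every dart to the next one,
counterclockwise, among the darts starting at the same vertex. Walking along a dart `d` and then
leaving along the dart that follows `dartRev d` in the rotation traces the boundaries of the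
regions of the drawing, each with the region on the right-hand side; so a face is an orbit of
`d ↦ rot (dartRev d)`, and bounded faces are traversed clockwise. One face is the unbounded one
(if there is no edge, there is one vertex and no boundary walk, and `outer` is empty). The surface
on which the drawing lives is the sphere, that is, Euler's formula
`#V - #E + #(bounded faces) + 1 = 2` holds. -/
structure PlaneGraph (V E : Type*) [Fintype V] [Fintype E] extends DirGraph V E where
  connected : toDirGraph.IsConnected
  rot : Equiv.Perm (E × Bool)
  rot_sameCycle_iff : ∀ d d', rot.SameCycle d d' ↔ toDirGraph.src d = toDirGraph.src d'
  outer : Set (Quotient (Equiv.Perm.SameCycle.setoid (rot * dartRev)))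
  exists_outer : Nonempty E → ∃ F, outer = {F}
  euler : Nat.card V + Nat.card {F // F ∉ outer} = Nat.card E + 1

namespace PlaneGraph

variable {V E : Type*} [Fintype V] [Fintype E] (G : PlaneGraph V E)

/-- The bounded faces. -/
abbrev BoundedFace : Type _ := {F // F ∉ G.outer}

/-- The boundary walk of `F` passes through the dart `d`. -/
def HasDart (F : G.BoundedFace) (d : E × Bool) : Prop :=
  (Quotient.mk (Equiv.Perm.SameCycle.setoid (G.rot * dartRev)) d) = F.1

open Classical in
/-- The cycle basis matrix: the entry at `(F, e)` is `1` or `-1` if `e` is an edge of the face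
cycle of `F` that points clockwise, respectively counterclockwise, around `F`, and `0` if `e` is not
on it. (An edge with `F` on both of its sides is a bridge, and belongs to no cycle.) -/
noncomputable def cycleMatrix (F : G.BoundedFace) (e : E) : ℤ :=
  (if G.HasDart F (e, true) then 1 else 0) - (if G.HasDart F (e, false) then 1 else 0)

/-- The edge `e` lies on the face cycle of `F`. -/
def OnFaceCycle (F : G.BoundedFace) (e : E) : Prop :=
  Xor (G.HasDart F (e, true)) (G.HasDart F (e, false))

/-- An edge-labeling is face-translatable if, for the cycle around each bounded face, some point
of the plane is a zero of all labels on that cycle. -/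
def FaceTranslatable {𝕜 : Type*} [Field 𝕜] (l : E → MvPolynomial (Fin 2) 𝕜) : Prop :=
  ∀ F : G.BoundedFace, ∃ x₀ y₀ : 𝕜, ∀ e, G.OnFaceCycle F e → eval ![x₀, y₀] (l e) = 0

/-- The extended cycle basis matrix for edge labels `(a x + b y + c)²`: the row of each bounded
face is replaced by three rows, weighted by `a²`, `a b`, `b²`. For `a = 1` the weights are
`1`, `b`, `b²`. -/
noncomputable def extMatrix {𝕜 : Type*} [Field 𝕜] (a b : E → 𝕜) :
    Matrix (G.BoundedFace × Fin 3) E 𝕜 :=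
  fun r e => (G.cycleMatrix r.1 e : 𝕜) * ![a e ^ 2, a e * b e, b e ^ 2] r.2

end PlaneGraph

/-- The polynomial `(a x + b y + c)²`. -/
noncomputable def affineSq {𝕜 : Type*} [Field 𝕜] (a b c : 𝕜) : MvPolynomial (Fin 2) 𝕜 :=
  (C a * X 0 + C b * X 1 + C c) ^ 2

namespace DirGraph

variable {V E : Type*} (G : DirGraph V E) {𝕜 : Type*} [Field 𝕜]
  (l : E → MvPolynomial (Fin 2) 𝕜)

/-- Splines on the edge-labeled graph `(G, l)`. -/
noncomputable def spl : Submodule 𝕜 (V → MvPolynomial (Fin 2) 𝕜) where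
  carrier := {p | ∀ e, l e ∣ p (G.head e) - p (G.tail e)}
  zero_mem' e := by simp
  add_mem' {p q} hp hq e := by
    have := dvd_add (hp e) (hq e)
    simpa [add_sub_add_comm] using this
  smul_mem' r p hp e := by
    have := (hp e).mul_left (C r)
    simpa [MvPolynomial.smul_eq_C_mul, mul_sub] using this

/-- Splines of degree at most `d`. -/
noncomputable def splLE (d : ℕ) : Submodule 𝕜 (V → MvPolynomial (Fin 2) 𝕜) :=
  G.spl l ⊓ Submodule.pi Set.univ fun _ => restrictTotalDegree (Fin 2) 𝕜 d

/-- Splines of degree at most `d` vanishing at the vertex `v₀`. -/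
noncomputable def splLEAt (d : ℕ) (v₀ : V) : Submodule 𝕜 (V → MvPolynomial (Fin 2) 𝕜) :=
  G.splLE l d ⊓ LinearMap.ker (LinearMap.proj v₀)

/-- Homogeneous splines of degree `d` (each value is zero or homogeneous of degree `d`) vanishing
at the vertex `v₀`. -/
noncomputable def splHomAt (d : ℕ) (v₀ : V) : Submodule 𝕜 (V → MvPolynomial (Fin 2) 𝕜) :=
  G.spl l ⊓ (Submodule.pi Set.univ fun _ => homogeneousSubmodule (Fin 2) 𝕜 d) ⊓
    LinearMap.ker (LinearMap.proj v₀)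

open Classical in
/-- The map sending a spline `p` to the family of polynomials `c e` on the edges with
`p (head e) - p (tail e) = c e * l e`. They are unique if no label is zero; the value is `0` where
no such polynomial exists, which does not happen for a spline. -/
noncomputable def cofactor (p : V → MvPolynomial (Fin 2) 𝕜) (e : E) : MvPolynomial (Fin 2) 𝕜 :=
  if h : l e ∣ p (G.head e) - p (G.tail e) then h.choose else 0

end DirGraph

/-- A planar triangulation: a finite simplicial complex in the plane in which each simplex is a
face of a triangle, that is connected through its edges (any two triangles are joined by a
sequence of triangles in which consecutive ones share an edge), and whose underlying region has no
holes. -/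
structure PlanarTriangulation where
  complex : Geometry.SimplicialComplex ℝ (ℝ × ℝ)
  finite : complex.faces.Finite
  pure : ∀ s ∈ complex.faces, ∃ t ∈ complex.faces, s ⊆ t ∧ t.card = 3
  nonempty : complex.faces.Nonempty
  edge_connected : ∀ t t' : {t // t ∈ complex.faces ∧ t.card = 3},
    Relation.ReflTransGen (fun t t' : {t // t ∈ complex.faces ∧ t.card = 3} =>
      ∃ e ∈ complex.faces, e.card = 2 ∧ e ⊆ t.1 ∧ e ⊆ t'.1) t t'
  no_holes : IsConnected (complex.spaceᶜ)

namespace PlanarTriangulation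

variable (Δ : PlanarTriangulation)

/-- The triangles of the triangulation. -/
abbrev Triangle : Type := {t // t ∈ Δ.complex.faces ∧ t.card = 3}

/-- The dual graph: one vertex for each triangle, and an edge between two distinct triangles that
share an edge of the triangulation. -/
def dualGraph : SimpleGraph Δ.Triangle where
  Adj t t' := t ≠ t' ∧ ∃ e ∈ Δ.complex.faces, e.card = 2 ∧ e ⊆ t.1 ∧ e ⊆ t'.1
  symm := ⟨fun _ _ ⟨h, e, he, h2, h3, h4⟩ => ⟨h.symm, e, he, h2, h4, h3⟩⟩
  loopless := ⟨fun _ h => h.1 rfl⟩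

/-- `G` is the dual graph, with some choice of a direction for each edge. -/
def IsDirectedDual (G : DirGraph Δ.Triangle Δ.dualGraph.edgeSet) : Prop :=
  ∀ e, s(G.tail e, G.head e) = e.1

end PlanarTriangulation

/-!
A spline `p` of degree at most `2` has constant cofactors `z e`, because the labels are quadratic,
and up to its value at `v₀` it is a potential of the edge function `z e * ℓ' e`. Everything
therefore reduces to which constants `z` make `z * ℓ'` exact, that is, a coboundary. Taking leading
forms, exactness of `z * ℓ'` implies that of `z * ℓ`.

On a plane graph the cycles around the bounded faces span the cycle space, by Euler's formula, so
exactness can be tested on them. Around one face, translating the common zero of its labels to the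
origin turns `ℓ'` into `ℓ`, and the coefficients of `z * ℓ` yield the three rows of the matrix.

The dual graph of a triangulation has a translation to the origin for every vertex of the
triangulation. Translating a potential of `z * ℓ` to a common vertex of two triangles makes it jump
by `z * ℓ'` between them; the discrepancies between the translations to the vertices of one edge
form a closed edge function on the complex. It is exact since a cycle in a planar complex
without holes bounds the triangles weighted by its winding numbers around them.

For the normal form, a generic similarity of the plane makes all coefficients of `x` nonzero.
-/

section Exactness

variable {k V E W M N : Type*} [Field k] [AddCommGroup W] [Module k W]
  [AddCommGroup M] [Module k M] [AddCommGroup N] [Module k N]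

theorem exists_comp_eq_of_ker_le {f : M →ₗ[k] N} {g : M →ₗ[k] W}
    (h : LinearMap.ker f ≤ LinearMap.ker g) : ∃ π : N →ₗ[k] W, π ∘ₗ f = g := by
  obtain ⟨π, hπ⟩ := LinearMap.exists_extend
    ((LinearMap.ker f).liftQ g h ∘ₗ f.quotKerEquivRange.symm.toLinearMap)
  refine ⟨π, LinearMap.ext fun x => ?_⟩
  have hx := LinearMap.congr_fun hπ (f.rangeRestrict x)
  have hfx : f.rangeRestrict x = f.quotKerEquivRange ((LinearMap.ker f).mkQ x) := rfl
  simpa [hfx] using hx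

namespace DirGraph

variable {G : DirGraph V E}

theorem IsConnected.iff_of_forall_edge (hG : G.IsConnected) {A : V → Prop}
    (hA : ∀ e, A (G.tail e) ↔ A (G.head e)) (u v : V) : A u ↔ A v := by
  induction hG.2 u v with
  | rel u v h =>
    obtain ⟨e, rfl, rfl⟩ := h
    exact hA e
  | refl u => rfl
  | symm u v _ ih => exact ih.symm
  | trans u v w _ _ ih₁ ih₂ => exact ih₁.trans ih₂

theorem IsConnected.sub_mem (hG : G.IsConnected) (S : Submodule k W)
    {p : V → W} (hp : ∀ e, p (G.head e) - p (G.tail e) ∈ S) (u v : V) : p v - p u ∈ S := by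
  refine (hG.iff_of_forall_edge (A := fun w => p w - p u ∈ S) (fun e => ?_) u v).1 (by simp)
  rw [← S.add_mem_iff_right (hp e), sub_add_sub_cancel]

theorem IsConnected.eq_of_diff_eq {W : Type*} [AddCommGroup W] (hG : G.IsConnected)
    {p q : V → W} {v₀ : V} (h₀ : p v₀ = q v₀)
    (h : ∀ e, p (G.head e) - p (G.tail e) = q (G.head e) - q (G.tail e)) : p = q := by
  funext v
  refine (hG.iff_of_forall_edge (A := fun w => p w = q w) (fun e => ?_) v₀ v).1 h₀
  rw [← sub_eq_zero, ← sub_eq_zero (b := q (G.head e)), sub_eq_sub_iff_sub_eq_sub.1 (h e)]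

/-- `f` is exact if it is the coboundary of a function on the vertices, the analogue of a gradient
field. -/
def IsExact {W : Type*} [AddCommGroup W] (G : DirGraph V E) (f : E → W) : Prop :=
  ∃ p : V → W, ∀ e, p (G.head e) - p (G.tail e) = f e

theorem IsExact.map {f : E → M} (hf : G.IsExact f) (φ : M →ₗ[k] N) : G.IsExact fun e => φ (f e) :=
  let ⟨p, hp⟩ := hf
  ⟨fun v => φ (p v), fun e => by rw [← map_sub, hp]⟩

variable (k) in
/-- The boundary operator of the graph, from chains of edges to chains of vertices. -/
noncomputable def boundary (G : DirGraph V E) : (E →₀ k) →ₗ[k] V →₀ k :=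
  Finsupp.linearCombination k fun e =>
    Finsupp.single (G.head e) 1 - Finsupp.single (G.tail e) 1

theorem linearCombination_boundary (p : V → W) (c : E →₀ k) :
    Finsupp.linearCombination k p (G.boundary k c) =
      Finsupp.linearCombination k (fun e => p (G.head e) - p (G.tail e)) c := by
  rw [boundary, Finsupp.apply_linearCombination]
  congr 2
  ext e
  simp

theorem isExact_of_ker_boundary_le {f : E → W}
    (h : LinearMap.ker (G.boundary k) ≤ LinearMap.ker (Finsupp.linearCombination k f)) :
    G.IsExact f := by
  obtain ⟨π, hπ⟩ := exists_comp_eq_of_ker_le h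
  refine ⟨fun v => π (Finsupp.single v 1), fun e => ?_⟩
  simpa [boundary] using LinearMap.congr_fun hπ (Finsupp.single e 1)

theorem IsConnected.range_boundary_sup_span_single (hG : G.IsConnected) (v₀ : V) :
    LinearMap.range (G.boundary k) ⊔ Submodule.span k {Finsupp.single v₀ 1} = ⊤ := by
  rw [eq_top_iff, ← (Finsupp.basisSingleOne (ι := V) (R := k)).span_eq, Submodule.span_le]
  rintro _ ⟨v, rfl⟩
  simp only [Finsupp.coe_basisSingleOne, SetLike.mem_coe]
  have hv : Finsupp.single v 1 - Finsupp.single v₀ 1 ∈ LinearMap.range (G.boundary k) :=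
    hG.sub_mem (LinearMap.range (G.boundary k)) (p := fun v => Finsupp.single v 1)
      (fun e => ⟨Finsupp.single e 1, by simp [boundary]⟩) v₀ v
  rw [← sub_add_cancel (Finsupp.single v 1) (Finsupp.single v₀ 1)]
  exact Submodule.add_mem_sup hv (Submodule.mem_span_singleton_self _)

theorem IsConnected.card_le_finrank_range_boundary_add_one [Fintype V] (hG : G.IsConnected) :
    Fintype.card V ≤ Module.finrank k (LinearMap.range (G.boundary k)) + 1 := by
  obtain ⟨v₀⟩ := hG.1
  calc Fintype.card V = Module.finrank k (V →₀ k) := (Module.finrank_finsupp_self k).symm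
    _ = Module.finrank k
          ↥(LinearMap.range (G.boundary k) ⊔ Submodule.span k {Finsupp.single v₀ 1}) := by
        rw [hG.range_boundary_sup_span_single v₀, finrank_top]
    _ ≤ Module.finrank k (LinearMap.range (G.boundary k)) +
          Module.finrank k (Submodule.span k {Finsupp.single v₀ (1 : k)}) :=
        Submodule.finrank_add_le_finrank_add_finrank _ _
    _ ≤ _ := by
        gcongr
        simpa using finrank_span_le_card (R := k) {Finsupp.single v₀ (1 : k)}

end DirGraph

end Exactness

/-- `g` is the nonzero homogeneous part of degree `d` of the polynomial `f` of degree `d`; for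
`f = (a x + b y + c)²` and `d = 2` it is the homogenization `(a x + b y)²`. -/
structure IsLeadingForm {σ k : Type*} [CommSemiring k] (d : ℕ) (f g : MvPolynomial σ k) :
    Prop where
  totalDegree_le : f.totalDegree ≤ d
  homogeneousComponent_eq : homogeneousComponent d f = g
  ne_zero : g ≠ 0

namespace IsLeadingForm

variable {σ k : Type*} {d : ℕ}

section CommSemiring

variable [CommSemiring k] {f g : MvPolynomial σ k}

theorem isHomogeneous (h : IsLeadingForm d f g) : g.IsHomogeneous d :=
  h.homogeneousComponent_eq ▸ homogeneousComponent_isHomogeneous d f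

theorem self (h : IsLeadingForm d f g) : IsLeadingForm d g g :=
  ⟨h.isHomogeneous.totalDegree_le, homogeneousComponent_eq_self h.isHomogeneous, h.ne_zero⟩

theorem left_ne_zero (h : IsLeadingForm d f g) : f ≠ 0 := by
  rintro rfl
  exact h.ne_zero (by rw [← h.homogeneousComponent_eq, map_zero])

theorem totalDegree_eq (h : IsLeadingForm d f g) : f.totalDegree = d := by
  refine le_antisymm h.totalDegree_le (not_lt.1 fun hlt => h.ne_zero ?_)
  rw [← h.homogeneousComponent_eq, homogeneousComponent_eq_zero _ _ hlt]

theorem homogeneousComponent_C_mul (h : IsLeadingForm d f g) (z : k) :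
    homogeneousComponent d (C z * f) = C z * g := by
  rw [MvPolynomial.homogeneousComponent_C_mul, h.homogeneousComponent_eq]

end CommSemiring

theorem exists_eq_C_mul_of_dvd [CommRing k] [IsDomain k] {f g p : MvPolynomial σ k}
    (h : IsLeadingForm d f g) (hp : p.totalDegree ≤ d) (hdvd : f ∣ p) : ∃ z, p = C z * f := by
  obtain ⟨q, rfl⟩ := hdvd
  by_cases hq : q = 0
  · exact ⟨0, by simp [hq]⟩
  rw [totalDegree_mul_of_isDomain h.left_ne_zero hq, h.totalDegree_eq] at hp
  have hq₀ : q.totalDegree = 0 := by lia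
  rw [totalDegree_eq_zero_iff_eq_C] at hq₀
  exact ⟨coeff 0 q, by rw [← hq₀, mul_comm]⟩

end IsLeadingForm

namespace DirGraph

variable {V E 𝕜 : Type*} {G : DirGraph V E} [Field 𝕜] {d : ℕ} {v₀ : V}
  {l l' : E → MvPolynomial (Fin 2) 𝕜} {p : V → MvPolynomial (Fin 2) 𝕜}

theorem mem_splLE : p ∈ G.splLE l d ↔
    (∀ e, l e ∣ p (G.head e) - p (G.tail e)) ∧ ∀ v, (p v).totalDegree ≤ d := by
  simp [splLE, spl, Submodule.mem_pi, mem_restrictTotalDegree]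

theorem mem_splLEAt : p ∈ G.splLEAt l d v₀ ↔ p ∈ G.splLE l d ∧ p v₀ = 0 := by
  simp [splLEAt]

theorem mem_splHomAt : p ∈ G.splHomAt l d v₀ ↔
    (∀ e, l e ∣ p (G.head e) - p (G.tail e)) ∧ (∀ v, (p v).IsHomogeneous d) ∧ p v₀ = 0 := by
  simp [splHomAt, spl, Submodule.mem_pi, and_assoc]

theorem cofactor_eq {e : E} {q : MvPolynomial (Fin 2) 𝕜} (hl : l e ≠ 0)
    (h : p (G.head e) - p (G.tail e) = q * l e) : G.cofactor l p e = q := by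
  have hd : l e ∣ p (G.head e) - p (G.tail e) := ⟨q, by rw [h, mul_comm]⟩
  rw [cofactor, dif_pos hd]
  exact mul_left_cancel₀ hl ((hd.choose_spec.symm.trans h).trans (mul_comm _ _))

theorem exists_sub_eq_C_mul (hl : ∀ e, IsLeadingForm d (l' e) (l e)) (hp : p ∈ G.splLE l' d) :
    ∃ z : E → 𝕜, ∀ e, p (G.head e) - p (G.tail e) = C (z e) * l' e := by
  rw [mem_splLE] at hp
  choose z hz using fun e => (hl e).exists_eq_C_mul_of_dvd
    ((totalDegree_sub _ _).trans (max_le (hp.2 (G.head e)) (hp.2 (G.tail e)))) (hp.1 e)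
  exact ⟨z, hz⟩

theorem IsConnected.exists_mem_splLEAt (hG : G.IsConnected) (hl : ∀ e, (l e).totalDegree ≤ d)
    (v₀ : V) {z : E → 𝕜} (hz : G.IsExact fun e => C (z e) * l e) :
    ∃ p ∈ G.splLEAt l d v₀, ∀ e, p (G.head e) - p (G.tail e) = C (z e) * l e := by
  obtain ⟨p, hp⟩ := hz
  refine ⟨fun v => p v - p v₀, mem_splLEAt.2 ⟨mem_splLE.2 ⟨fun e => ?_, fun v => ?_⟩, sub_self _⟩,
    fun e => by simp [hp]⟩
  · simp [hp]
  · rw [← mem_restrictTotalDegree]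
    refine hG.sub_mem _ (fun e => ?_) v₀ v
    rw [hp, mem_restrictTotalDegree]
    exact (totalDegree_mul _ _).trans (by simpa using hl e)

theorem IsConnected.cofactor_image_splLE (hG : G.IsConnected)
    (hl : ∀ e, IsLeadingForm d (l' e) (l e)) :
    G.cofactor l' '' (G.splLE l' d : Set (V → MvPolynomial (Fin 2) 𝕜)) =
      {f | ∃ z : E → 𝕜, (G.IsExact fun e => C (z e) * l' e) ∧ ∀ e, f e = C (z e)} := by
  ext f
  constructor
  · rintro ⟨p, hp, rfl⟩
    obtain ⟨z, hz⟩ := exists_sub_eq_C_mul hl hp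
    exact ⟨z, ⟨p, hz⟩, fun e => cofactor_eq (hl e).left_ne_zero (hz e)⟩
  · rintro ⟨z, hz, hf⟩
    obtain ⟨v₀⟩ := hG.1
    obtain ⟨p, hp, hpz⟩ := hG.exists_mem_splLEAt (fun e => (hl e).totalDegree_le) v₀ hz
    exact ⟨p, (mem_splLEAt.1 hp).1, funext fun e =>
      (cofactor_eq (hl e).left_ne_zero (hpz e)).trans (hf e).symm⟩

theorem IsExact.of_isLeadingForm (hl : ∀ e, IsLeadingForm d (l' e) (l e)) {z : E → 𝕜}
    (hz : G.IsExact fun e => C (z e) * l' e) : G.IsExact fun e => C (z e) * l e := by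
  simpa only [(hl _).homogeneousComponent_C_mul] using hz.map (homogeneousComponent d)

theorem IsConnected.splLEAt_eq_splHomAt (hG : G.IsConnected)
    (hl : ∀ e, IsLeadingForm d (l e) (l e)) (v₀ : V) :
    G.splLEAt l d v₀ = G.splHomAt l d v₀ := by
  ext p
  rw [mem_splLEAt, mem_splHomAt]
  refine ⟨fun ⟨hp, h₀⟩ => ⟨(mem_splLE.1 hp).1, fun v => ?_, h₀⟩, fun ⟨hdvd, hhom, h₀⟩ =>
    ⟨mem_splLE.2 ⟨hdvd, fun v => (hhom v).totalDegree_le⟩, h₀⟩⟩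
  obtain ⟨z, hz⟩ := exists_sub_eq_C_mul hl hp
  have hmem := hG.sub_mem (homogeneousSubmodule (Fin 2) 𝕜 d) (p := p) (fun e => by
    rw [hz, mem_homogeneousSubmodule]
    exact (hl e).isHomogeneous.C_mul _) v₀ v
  rwa [mem_homogeneousSubmodule, h₀, sub_zero] at hmem

theorem homogeneousComponent_comp_mem_splHomAt (hl : ∀ e, IsLeadingForm d (l' e) (l e))
    (hp : p ∈ G.splLEAt l' d v₀) :
    (homogeneousComponent d).compLeft V p ∈ G.splHomAt l d v₀ := by
  rw [mem_splLEAt] at hp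
  obtain ⟨z, hz⟩ := exists_sub_eq_C_mul hl hp.1
  refine mem_splHomAt.2
    ⟨fun e => ?_, fun v => homogeneousComponent_isHomogeneous _ _, by simp [hp.2]⟩
  simp only [LinearMap.compLeft_apply, Function.comp_apply]
  rw [← map_sub, hz, (hl e).homogeneousComponent_C_mul]
  exact dvd_mul_left _ _

/-- The map taking a spline of degree at most `d` to its homogeneous part of degree `d`. -/
noncomputable def topPart (hl : ∀ e, IsLeadingForm d (l' e) (l e)) (v₀ : V) :
    G.splLEAt l' d v₀ →ₗ[𝕜] G.splHomAt l d v₀ :=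
  ((homogeneousComponent d).compLeft V).restrict fun _ => homogeneousComponent_comp_mem_splHomAt hl

theorem topPart_apply (hl : ∀ e, IsLeadingForm d (l' e) (l e)) (p : G.splLEAt l' d v₀) (v : V) :
    (topPart hl v₀ p).1 v = homogeneousComponent d (p.1 v) :=
  rfl

theorem topPart_sub (hl : ∀ e, IsLeadingForm d (l' e) (l e)) (p : G.splLEAt l' d v₀) {e : E}
    {z : 𝕜} (hz : p.1 (G.head e) - p.1 (G.tail e) = C z * l' e) :
    (topPart hl v₀ p).1 (G.head e) - (topPart hl v₀ p).1 (G.tail e) = C z * l e := by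
  rw [topPart_apply, topPart_apply, ← map_sub, hz, (hl e).homogeneousComponent_C_mul]

theorem cofactor_topPart (hl : ∀ e, IsLeadingForm d (l' e) (l e)) (p : G.splLEAt l' d v₀) :
    G.cofactor l (topPart hl v₀ p).1 = G.cofactor l' p.1 := by
  obtain ⟨z, hz⟩ := exists_sub_eq_C_mul hl (mem_splLEAt.1 p.2).1
  funext e
  rw [cofactor_eq (hl e).left_ne_zero (hz e),
    cofactor_eq (hl e).ne_zero (topPart_sub hl p (hz e))]

theorem IsConnected.topPart_injective (hG : G.IsConnected)
    (hl : ∀ e, IsLeadingForm d (l' e) (l e)) :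
    Function.Injective (topPart (G := G) hl v₀) := by
  rw [← LinearMap.ker_eq_bot, LinearMap.ker_eq_bot']
  intro p hp
  obtain ⟨z, hz⟩ := exists_sub_eq_C_mul hl (mem_splLEAt.1 p.2).1
  ext1
  refine hG.eq_of_diff_eq (v₀ := v₀) (mem_splLEAt.1 p.2).2 fun e => ?_
  have htop := topPart_sub hl p (hz e)
  rw [hp] at htop
  have hz₀ : C (σ := Fin 2) (z e) = 0 := by simpa [(hl e).ne_zero] using htop
  simp [hz e, hz₀]

theorem IsConnected.topPart_surjective (hG : G.IsConnected)
    (hl : ∀ e, IsLeadingForm d (l' e) (l e))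
    (hlift : ∀ z : E → 𝕜, (G.IsExact fun e => C (z e) * l e) → G.IsExact fun e => C (z e) * l' e) :
    Function.Surjective (topPart (G := G) hl v₀) := by
  rintro ⟨q, hq⟩
  have hq' := hq
  rw [← hG.splLEAt_eq_splHomAt (fun e => (hl e).self), mem_splLEAt] at hq'
  obtain ⟨z, hz⟩ := exists_sub_eq_C_mul (fun e => (hl e).self) hq'.1
  obtain ⟨p, hp, hpz⟩ :=
    hG.exists_mem_splLEAt (fun e => (hl e).totalDegree_le) v₀ (hlift z ⟨q, hz⟩)
  refine ⟨⟨p, hp⟩, Subtype.ext (hG.eq_of_diff_eq (v₀ := v₀) ?_ fun e => ?_)⟩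
  · simp [topPart_apply, (mem_splLEAt.1 hp).2, hq'.2]
  · rw [topPart_sub hl ⟨p, hp⟩ (hpz e), hz]

/-- A spline of degree at most `d` is the sum of its value at `v₀` and a spline vanishing there. -/
noncomputable def splLEEquiv (G : DirGraph V E) (l : E → MvPolynomial (Fin 2) 𝕜) (d : ℕ) (v₀ : V) :
    G.splLE l d ≃ₗ[𝕜] restrictTotalDegree (Fin 2) 𝕜 d × G.splLEAt l d v₀ where
  toFun p := (⟨p.1 v₀, (mem_restrictTotalDegree _ _ _).2 ((mem_splLE.1 p.2).2 v₀)⟩,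
    ⟨fun v => p.1 v - p.1 v₀, mem_splLEAt.2 ⟨mem_splLE.2
      ⟨fun e => by simpa using (mem_splLE.1 p.2).1 e, fun v => (totalDegree_sub _ _).trans
        (max_le ((mem_splLE.1 p.2).2 v) ((mem_splLE.1 p.2).2 v₀))⟩, sub_self _⟩⟩)
  invFun x := ⟨fun v => x.2.1 v + x.1.1, mem_splLE.2
    ⟨fun e => by simpa using (mem_splLE.1 (mem_splLEAt.1 x.2.2).1).1 e,
      fun v => (totalDegree_add _ _).trans
        (max_le ((mem_splLE.1 (mem_splLEAt.1 x.2.2).1).2 v)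
          ((mem_restrictTotalDegree _ _ _).1 x.1.2))⟩⟩
  map_add' p q := Prod.ext rfl (Subtype.ext (funext fun v => by simp [add_sub_add_comm]))
  map_smul' r p := Prod.ext rfl (Subtype.ext (funext fun v => by simp [smul_sub]))
  left_inv p := Subtype.ext (funext fun v => by simp)
  right_inv x := by
    have h₀ := (mem_splLEAt.1 x.2.2).2
    exact Prod.ext (Subtype.ext (by simp [h₀])) (Subtype.ext (funext fun v => by simp [h₀]))

theorem IsConnected.exists_splLEAt_equiv_splHomAt (hG : G.IsConnected)
    (hl : ∀ e, IsLeadingForm d (l' e) (l e))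
    (hlift : ∀ z : E → 𝕜, (G.IsExact fun e => C (z e) * l e) → G.IsExact fun e => C (z e) * l' e) :
    (∀ v₀ : V,
      (∃ Ψ : G.splLEAt l' d v₀ ≃ₗ[𝕜] G.splHomAt l d v₀,
        ∀ p, G.cofactor l (Ψ p).1 = G.cofactor l' p.1) ∧
      G.splLEAt l d v₀ = G.splHomAt l d v₀) ∧
    Nonempty (G.splLE l' d ≃ₗ[𝕜] G.splLE l d) := by
  let Ψ (v₀ : V) : G.splLEAt l' d v₀ ≃ₗ[𝕜] G.splHomAt l d v₀ := LinearEquiv.ofBijective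
    (topPart hl v₀) ⟨hG.topPart_injective hl, hG.topPart_surjective hl hlift⟩
  have heq := hG.splLEAt_eq_splHomAt fun e => (hl e).self
  refine ⟨fun v₀ => ⟨⟨Ψ v₀, cofactor_topPart hl⟩, heq v₀⟩, ?_⟩
  obtain ⟨v₀⟩ := hG.1
  exact ⟨(G.splLEEquiv l' d v₀).trans (((LinearEquiv.refl 𝕜 _).prodCongr
    ((Ψ v₀).trans (LinearEquiv.ofEq _ _ (heq v₀).symm))).trans (G.splLEEquiv l d v₀).symm)⟩

end DirGraph

namespace PlaneGraph

variable {V E : Type*} [Fintype V] [Fintype E] (G : PlaneGraph V E)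

/-- The face whose boundary walk passes through a dart. -/
def face (d : E × Bool) : Quotient (Equiv.Perm.SameCycle.setoid (G.rot * dartRev)) :=
  Quotient.mk _ d

variable {G} in
theorem hasDart_iff {F : G.BoundedFace} {d : E × Bool} : G.HasDart F d ↔ G.face d = F.1 := Iff.rfl

theorem face_rot_dartRev (d : E × Bool) : G.face (G.rot (dartRev d)) = G.face d :=
  Quotient.sound (Equiv.Perm.sameCycle_apply_left.2 (Equiv.Perm.SameCycle.refl _ _))

theorem src_rot (d : E × Bool) : G.src (G.rot d) = G.src d :=
  (G.rot_sameCycle_iff _ _).1 (Equiv.Perm.sameCycle_apply_left.2 (Equiv.Perm.SameCycle.refl _ d))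

theorem face_invariant_of_src_eq {α : Type*}
    {μ : Quotient (Equiv.Perm.SameCycle.setoid (G.rot * dartRev)) → α}
    (hμ : ∀ e, μ (G.face (e, true)) = μ (G.face (e, false))) {d d' : E × Bool}
    (hd : G.src d = G.src d') : μ (G.face d) = μ (G.face d') := by
  have hrev : ∀ d, μ (G.face (dartRev d)) = μ (G.face d) := by
    rintro ⟨e, _ | _⟩
    · exact hμ e
    · exact (hμ e).symm
  have hrot (d) : μ (G.face (G.rot d)) = μ (G.face d) := by
    simpa [dartRev, hrev] using (congrArg μ (G.face_rot_dartRev (dartRev d))).trans (hrev d)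
  have hpow : ∀ (n : ℕ) d, μ (G.face ((G.rot ^ n) d)) = μ (G.face d) := by
    intro n
    induction n with
    | zero => simp
    | succ n ih => intro d; rw [pow_succ, Equiv.Perm.mul_apply, ih, hrot]
  obtain ⟨n, rfl⟩ := ((G.rot_sameCycle_iff d d').2 hd).exists_nat_pow_eq
  exact (hpow n d).symm

theorem eq_of_forall_edge_face_eq {α : Type*}
    {μ : Quotient (Equiv.Perm.SameCycle.setoid (G.rot * dartRev)) → α}
    (hμ : ∀ e, μ (G.face (e, true)) = μ (G.face (e, false))) (F F' : Quotient _) : μ F = μ F' := by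
  obtain ⟨d, rfl⟩ := Quotient.exists_rep F
  obtain ⟨d', rfl⟩ := Quotient.exists_rep F'
  let A (v : V) : Prop := ∀ d, G.src d = v → μ (G.face d) = μ (G.face d')
  have hA (d) : A (G.src d) ↔ μ (G.face d) = μ (G.face d') :=
    ⟨fun h => h d rfl, fun h d'' hd => (G.face_invariant_of_src_eq hμ hd).trans h⟩
  refine (hA d).1 ((G.connected.iff_of_forall_edge (fun e => ?_) (G.src d') (G.src d)).1
    ((hA d').2 rfl))
  exact (hA (e, true)).trans ((hμ e) ▸ (hA (e, false)).symm)

section FaceCycles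

variable (k : Type*) [Field k]

/-- The cycle around a bounded face, traversed clockwise, as a chain of edges. -/
noncomputable def faceCycle (F : G.BoundedFace) : E →₀ k :=
  Finsupp.equivFunOnFinite.symm fun e => (G.cycleMatrix F e : k)

variable {k} {W : Type*} [AddCommGroup W] [Module k W]

theorem linearCombination_faceCycle (f : E → W) (F : G.BoundedFace) :
    Finsupp.linearCombination k f (G.faceCycle k F) = ∑ e, (G.cycleMatrix F e : k) • f e := by
  simp [faceCycle, Finsupp.linearCombination_apply, Finsupp.sum_fintype]

theorem sum_cycleMatrix_smul_sub (F : G.BoundedFace) (p : V → W) :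
    ∑ e, (G.cycleMatrix F e : k) • (p (G.head e) - p (G.tail e)) = 0 := by
  classical
  have hshift : ∑ d with G.HasDart F d, p (G.src (dartRev d)) =
      ∑ d with G.HasDart F d, p (G.src d) := by
    simp_rw [Finset.sum_filter]
    rw [← Equiv.sum_comp (G.rot * dartRev) fun d => if G.HasDart F d then p (G.src d) else 0]
    simp only [Equiv.Perm.mul_apply, src_rot, hasDart_iff, face_rot_dartRev]
  rw [← sub_eq_zero, ← Finset.sum_sub_distrib, Finset.sum_filter, Fintype.sum_prod_type] at hshift
  rw [← hshift]
  refine Finset.sum_congr rfl fun e _ => ?_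
  simp only [Fintype.sum_bool, cycleMatrix, DirGraph.src, dartRev, Equiv.coe_fn_mk]
  by_cases ht : G.HasDart F (e, true) <;> by_cases hf : G.HasDart F (e, false) <;> simp [ht, hf]

theorem boundary_faceCycle (F : G.BoundedFace) : G.boundary k (G.faceCycle k F) = 0 := by
  rw [DirGraph.boundary, linearCombination_faceCycle]
  exact G.sum_cycleMatrix_smul_sub F fun v => Finsupp.single v 1

open Classical in
theorem sum_mul_hasDart_eq_extend [Fintype G.BoundedFace] (g : G.BoundedFace → k) (d : E × Bool) :
    ∑ F, g F * (if G.HasDart F d then 1 else 0) = Function.extend Subtype.val g 0 (G.face d) := by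
  by_cases hF : G.face d ∈ G.outer
  · rw [Function.extend_apply' _ _ _ fun ⟨F, hFd⟩ => F.2 (hFd ▸ hF)]
    refine Finset.sum_eq_zero fun F _ => ?_
    rw [if_neg fun h : G.HasDart F d => F.2 (hasDart_iff.1 h ▸ hF), mul_zero]
  · rw [Finset.sum_eq_single ⟨G.face d, hF⟩]
    · simpa [hasDart_iff] using (Subtype.val_injective.extend_apply g 0 ⟨G.face d, hF⟩).symm
    · intro F _ hFd
      rw [if_neg fun h : G.HasDart F d => hFd (Subtype.ext (hasDart_iff.1 h).symm), mul_zero]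
    · simp

variable (k) in
theorem linearIndependent_faceCycle : LinearIndependent k (G.faceCycle k) := by
  classical
  cases nonempty_fintype G.BoundedFace
  refine Fintype.linearIndependent_iff.2 fun g hg F => ?_
  have hsides (e : E) : Function.extend Subtype.val g 0 (G.face (e, true)) =
      Function.extend Subtype.val g 0 (G.face (e, false)) := by
    have he := DFunLike.congr_fun hg e
    simp only [faceCycle, Finsupp.finsetSum_apply, Finsupp.smul_apply,
      Finsupp.equivFunOnFinite_symm_apply_apply, cycleMatrix, smul_eq_mul, Int.cast_sub,
      Int.cast_ite, Int.cast_one, Int.cast_zero, mul_sub, Finset.sum_sub_distrib,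
      Finsupp.coe_zero, Pi.zero_apply, sum_mul_hasDart_eq_extend] at he
    exact sub_eq_zero.1 he
  obtain ⟨d, -⟩ := Quotient.exists_rep F.1
  obtain ⟨F₀, hF₀⟩ := G.exists_outer ⟨d.1⟩
  rw [← Subtype.val_injective.extend_apply g 0 F, G.eq_of_forall_edge_face_eq hsides F.1 F₀]
  exact Function.extend_apply' _ _ _ fun ⟨F, hF⟩ => F.2 (by simp [hF, hF₀])

variable (k) in
theorem span_faceCycle_eq_ker_boundary :
    Submodule.span k (Set.range (G.faceCycle k)) = LinearMap.ker (G.boundary k) := by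
  cases nonempty_fintype G.BoundedFace
  refine Submodule.eq_of_le_of_finrank_le
    (Submodule.span_le.2 (Set.range_subset_iff.2 G.boundary_faceCycle)) ?_
  have hspan := finrank_span_eq_card (G.linearIndependent_faceCycle k)
  have hnullity := (G.boundary k).finrank_range_add_finrank_ker
  have hrank := G.connected.card_le_finrank_range_boundary_add_one (k := k)
  have heuler := G.euler
  rw [Module.finrank_finsupp_self] at hnullity
  simp only [Nat.card_eq_fintype_card] at heuler
  lia

variable (k) in
theorem isExact_iff (f : E → W) :
    G.IsExact f ↔ ∀ F, ∑ e, (G.cycleMatrix F e : k) • f e = 0 := by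
  constructor
  · rintro ⟨p, hp⟩ F
    simpa only [hp] using G.sum_cycleMatrix_smul_sub (k := k) F p
  · intro h
    refine DirGraph.isExact_of_ker_boundary_le (k := k) ?_
    rw [← G.span_faceCycle_eq_ker_boundary k, Submodule.span_le]
    rintro _ ⟨F, rfl⟩
    exact (G.linearCombination_faceCycle f F).trans (h F)

end FaceCycles

end PlaneGraph

section AffineSquares

variable {k : Type*} [Field k] {a b : k}

theorem isHomogeneous_affineSq_zero (a b : k) : (affineSq a b 0).IsHomogeneous 2 := by
  have hlin : (C a * X 0 + C b * X 1 : MvPolynomial (Fin 2) k).IsHomogeneous 1 :=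
    (isHomogeneous_C_mul_X a 0).add (isHomogeneous_C_mul_X b 1)
  simpa [affineSq] using hlin.pow 2

theorem totalDegree_affineSq_sub_le (a b c : k) :
    (affineSq a b c - affineSq a b 0).totalDegree ≤ 1 := by
  have hlin : (C a * X 0 + C b * X 1 : MvPolynomial (Fin 2) k).totalDegree ≤ 1 :=
    ((isHomogeneous_C_mul_X a 0).add (isHomogeneous_C_mul_X b 1)).totalDegree_le
  have hsub : affineSq a b c - affineSq a b 0 =
      C (2 * c) * (C a * X 0 + C b * X 1) + C (c ^ 2) := by
    simp only [affineSq, map_mul, map_pow, map_ofNat, map_zero]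
    ring
  rw [hsub]
  refine (totalDegree_add _ _).trans (max_le ((totalDegree_mul _ _).trans ?_) ?_)
  · rwa [totalDegree_C, zero_add]
  · rw [totalDegree_C]
    exact zero_le_one

theorem affineSq_zero_ne_zero (h : a ≠ 0 ∨ b ≠ 0) : affineSq a b 0 ≠ 0 := by
  intro h₀
  rcases h with h | h
  · simpa [affineSq, h] using congrArg (eval ![1, 0]) h₀
  · simpa [affineSq, h] using congrArg (eval ![0, 1]) h₀

theorem isLeadingForm_affineSq (h : a ≠ 0 ∨ b ≠ 0) (c : k) :
    IsLeadingForm 2 (affineSq a b c) (affineSq a b 0) := by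
  have hhom := isHomogeneous_affineSq_zero a b
  have hlow := totalDegree_affineSq_sub_le a b c
  have hsum := add_sub_cancel (affineSq a b 0) (affineSq a b c)
  refine ⟨?_, ?_, affineSq_zero_ne_zero h⟩
  · rw [← hsum]
    exact (totalDegree_add _ _).trans (max_le hhom.totalDegree_le (by lia))
  · rw [← hsum, map_add, homogeneousComponent_eq_self hhom,
      homogeneousComponent_eq_zero _ _ (by lia), add_zero]

/-- The substitution of `X i - x i` for each variable `X i`, which moves the zeros by `x`. -/
noncomputable def polyTranslate {σ k : Type*} [CommRing k] (x : σ → k) :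
    MvPolynomial σ k →ₐ[k] MvPolynomial σ k :=
  aeval fun i => X i - C (x i)

theorem polyTranslate_affineSq_zero {a b c : k} {x : Fin 2 → k} (h : a * x 0 + b * x 1 + c = 0) :
    polyTranslate x (affineSq a b 0) = affineSq a b c := by
  obtain rfl : c = -(a * x 0 + b * x 1) := by linear_combination h
  simp only [polyTranslate, affineSq, map_pow, map_add, map_mul, algHom_C, algebraMap_eq, aeval_X,
    map_neg, map_zero]
  ring

theorem sum_C_mul_affineSq_zero_eq_zero_iff {ι : Type*} (h2 : (2 : k) ≠ 0) (s : Finset ι)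
    (w a b : ι → k) : ∑ i ∈ s, C (w i) * affineSq (a i) (b i) 0 = 0 ↔
      ∑ i ∈ s, w i * a i ^ 2 = 0 ∧ ∑ i ∈ s, w i * (a i * b i) = 0 ∧ ∑ i ∈ s, w i * b i ^ 2 = 0 := by
  have hexpand : ∑ i ∈ s, C (w i) * affineSq (a i) (b i) 0 =
      C (∑ i ∈ s, w i * a i ^ 2) * X 0 ^ 2 + C (∑ i ∈ s, w i * (a i * b i)) * (2 * (X 0 * X 1)) +
        C (∑ i ∈ s, w i * b i ^ 2) * X 1 ^ 2 := by
    simp only [map_sum, Finset.sum_mul, ← Finset.sum_add_distrib]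
    refine Finset.sum_congr rfl fun i _ => ?_
    simp only [affineSq, map_mul, map_pow, map_zero]
    ring
  rw [hexpand]
  refine ⟨fun h₀ => ?_, fun ⟨haa, hab, hbb⟩ => by simp [haa, hab, hbb]⟩
  have haa : ∑ i ∈ s, w i * a i ^ 2 = 0 := by simpa using congrArg (eval ![1, 0]) h₀
  have hbb : ∑ i ∈ s, w i * b i ^ 2 = 0 := by simpa using congrArg (eval ![0, 1]) h₀
  have hab : (∑ i ∈ s, w i * (a i * b i)) * 2 = 0 := by
    simpa [haa, hbb, -mul_eq_zero] using congrArg (eval ![1, 1]) h₀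
  exact ⟨haa, (mul_eq_zero.1 hab).resolve_right h2, hbb⟩

end AffineSquares

namespace PlaneGraph

variable {V E : Type*} [Fintype V] [Fintype E] (G : PlaneGraph V E) {k : Type*} [Field k]
  {a b c : E → k}

theorem cycleMatrix_eq_zero {F : G.BoundedFace} {e : E} (h : ¬ G.OnFaceCycle F e) :
    G.cycleMatrix F e = 0 := by
  rw [OnFaceCycle, xor_def] at h
  simp only [cycleMatrix]
  by_cases ht : G.HasDart F (e, true) <;> by_cases hf : G.HasDart F (e, false) <;> simp_all

theorem extMatrix_mulVec_eq_zero_iff (h2 : (2 : k) ≠ 0) (z : E → k) :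
    (G.extMatrix a b).mulVec z = 0 ↔ G.IsExact fun e => C (z e) * affineSq (a e) (b e) 0 := by
  have hsmul (F : G.BoundedFace) (e : E) :
      (G.cycleMatrix F e : k) • (C (z e) * affineSq (a e) (b e) 0) =
        C (G.cycleMatrix F e * z e) * affineSq (a e) (b e) 0 := by
    rw [smul_eq_C_mul, map_mul, mul_assoc]
  simp only [G.isExact_iff k, hsmul, sum_C_mul_affineSq_zero_eq_zero_iff h2, funext_iff,
    Prod.forall, Fin.forall_fin_succ, Matrix.mulVec, dotProduct, extMatrix, Pi.zero_apply,
    mul_right_comm _ (z _)]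
  simp

variable {G}

/-- Translating a point of the face to the origin turns the labels of its cycle into their leading
forms, so the condition on that face cycle is the same for both labelings. -/
theorem FaceTranslatable.isExact_of_isExact_zero
    (hG : G.FaceTranslatable fun e => affineSq (a e) (b e) (c e)) {z : E → k}
    (hz : G.IsExact fun e => C (z e) * affineSq (a e) (b e) 0) :
    G.IsExact fun e => C (z e) * affineSq (a e) (b e) (c e) := by
  rw [G.isExact_iff k] at hz ⊢
  intro F
  obtain ⟨x₀, y₀, hF⟩ := hG F
  rw [← map_zero (polyTranslate ![x₀, y₀]), ← hz F, map_sum]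
  refine Finset.sum_congr rfl fun e _ => ?_
  by_cases he : G.OnFaceCycle F e
  · have hline : a e * x₀ + b e * y₀ + c e = 0 := by simpa [affineSq] using hF e he
    rw [map_smul, map_mul, polyTranslate_affineSq_zero (by simpa using hline), algHom_C,
      algebraMap_eq]
  · simp [G.cycleMatrix_eq_zero he]

theorem FaceTranslatable.cofactor_image_splLE (h2 : (2 : k) ≠ 0) (hab : ∀ e, a e ≠ 0 ∨ b e ≠ 0)
    (hG : G.FaceTranslatable fun e => affineSq (a e) (b e) (c e)) :
    G.cofactor (fun e => affineSq (a e) (b e) (c e)) ''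
        (G.splLE (fun e => affineSq (a e) (b e) (c e)) 2 : Set (V → MvPolynomial (Fin 2) k)) =
      {f | ∃ z : E → k, (G.extMatrix a b).mulVec z = 0 ∧ ∀ e, f e = C (z e)} := by
  have hl (e) := isLeadingForm_affineSq (hab e) (c e)
  simp only [G.connected.cofactor_image_splLE hl, G.extMatrix_mulVec_eq_zero_iff h2]
  have hiff (z : E → k) : (G.IsExact fun e => C (z e) * affineSq (a e) (b e) (c e)) ↔
      G.IsExact fun e => C (z e) * affineSq (a e) (b e) 0 :=
    ⟨.of_isLeadingForm hl, hG.isExact_of_isExact_zero⟩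
  simp only [hiff]

end PlaneGraph

section Substitutions

variable {σ R : Type*} [CommRing R]

theorem totalDegree_aeval_le_of_isHomogeneous {τ : Type*} {d : ℕ} {f : σ → MvPolynomial τ R}
    (hf : ∀ i, (f i).IsHomogeneous 1) {p : MvPolynomial σ R} (hp : p.totalDegree ≤ d) :
    (aeval f p).totalDegree ≤ d := by
  rw [← sum_homogeneousComponent p, map_sum]
  refine totalDegree_finsetSum_le fun i hi => ?_
  refine ((homogeneousComponent_isHomogeneous i p).aeval f hf).totalDegree_le.trans ?_
  have := Finset.mem_range.1 hi
  lia

theorem eval_symm_X_algEquiv (τ : MvPolynomial σ R ≃ₐ[R] MvPolynomial σ R) (x : σ → R)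
    (p : MvPolynomial σ R) : eval (fun i => eval x (τ.symm (X i))) (τ p) = eval x p := by
  have h : (aeval fun i => eval x (τ.symm (X i))) = (aeval x).comp τ.symm.toAlgHom := by
    ext i
    simp
  simpa [coe_aeval_eq_eval] using DFunLike.congr_fun h (τ p)

theorem exists_forall_eval_ne_zero {ι : Type*} [Finite ι] [IsDomain R] [Infinite R]
    {p : ι → Polynomial R} (hp : ∀ i, p i ≠ 0) : ∃ t, ∀ i, (p i).eval t ≠ 0 := by
  cases nonempty_fintype ι
  obtain ⟨t, ht⟩ : ∃ t, (∏ i, p i).eval t ≠ 0 := by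
    by_contra! h
    have hprod : ∏ i, p i = 0 := Polynomial.funext fun t => by simpa using h t
    exact Finset.prod_ne_zero_iff.2 (fun i _ => hp i) hprod
  rw [Polynomial.eval_prod] at ht
  exact ⟨t, fun i => Finset.prod_ne_zero_iff.1 ht i (Finset.mem_univ i)⟩

end Substitutions

section Similarity

variable {k : Type*} [Field k]

/-- The substitution `x ↦ r x - s y`, `y ↦ s x + r y`. -/
noncomputable def similarityHom (r s : k) : MvPolynomial (Fin 2) k →ₐ[k] MvPolynomial (Fin 2) k :=
  aeval ![C r * X 0 - C s * X 1, C s * X 0 + C r * X 1]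

theorem similarityHom_X_zero (r s : k) : similarityHom r s (X 0) = C r * X 0 - C s * X 1 := by
  simp [similarityHom]

theorem similarityHom_X_one (r s : k) : similarityHom r s (X 1) = C s * X 0 + C r * X 1 := by
  simp [similarityHom]

theorem totalDegree_similarityHom_le (r s : k) {d : ℕ} {p : MvPolynomial (Fin 2) k}
    (hp : p.totalDegree ≤ d) : (similarityHom r s p).totalDegree ≤ d := by
  refine totalDegree_aeval_le_of_isHomogeneous (Fin.forall_fin_two.2 ⟨?_, ?_⟩) hp
  · exact (isHomogeneous_C_mul_X r 0).sub (isHomogeneous_C_mul_X s 1)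
  · exact (isHomogeneous_C_mul_X s 0).add (isHomogeneous_C_mul_X r 1)

/-- The two hypotheses say that `(r + s i) (r' + s' i) = 1`. -/
theorem similarityHom_comp_eq_id {r s r' s' : k} (hre : r * r' - s * s' = 1)
    (him : r * s' + s * r' = 0) :
    (similarityHom r s).comp (similarityHom r' s') = AlgHom.id k _ := by
  have hre' : (C r * C r' - C s * C s' : MvPolynomial (Fin 2) k) = 1 := by
    simp only [← C_mul, ← C_sub, hre, C_1]
  have him' : (C r * C s' + C s * C r' : MvPolynomial (Fin 2) k) = 0 := by
    simp only [← C_mul, ← C_add, him, C_0]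
  refine algHom_ext (Fin.forall_fin_two.2 ⟨?_, ?_⟩)
  · simp only [AlgHom.comp_apply, similarityHom_X_zero, map_sub, map_mul, algHom_C,
      algebraMap_eq, similarityHom_X_one, AlgHom.id_apply]
    linear_combination X 0 * hre' - X 1 * him'
  · simp only [AlgHom.comp_apply, similarityHom_X_zero, map_add, map_mul, algHom_C,
      algebraMap_eq, similarityHom_X_one, AlgHom.id_apply]
    linear_combination X 1 * hre' + X 0 * him'

/-- The substitution `similarityHom r s` as an automorphism; the inverse corresponds to the
complex number `(r + s i)⁻¹`. -/
noncomputable def similarity (r s : k) (h : r ^ 2 + s ^ 2 ≠ 0) :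
    MvPolynomial (Fin 2) k ≃ₐ[k] MvPolynomial (Fin 2) k :=
  AlgEquiv.ofAlgHom (similarityHom r s) (similarityHom (r / (r ^ 2 + s ^ 2)) (-s / (r ^ 2 + s ^ 2)))
    (similarityHom_comp_eq_id (by field_simp; ring) (by field_simp; ring))
    (similarityHom_comp_eq_id (by field_simp; ring) (by field_simp; ring))

theorem totalDegree_similarity_le_iff {r s : k} (h : r ^ 2 + s ^ 2 ≠ 0) {d : ℕ}
    {p : MvPolynomial (Fin 2) k} : (similarity r s h p).totalDegree ≤ d ↔ p.totalDegree ≤ d := by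
  refine ⟨fun hp => ?_, totalDegree_similarityHom_le r s⟩
  rw [← (similarity r s h).symm_apply_apply p]
  exact totalDegree_similarityHom_le _ _ hp

theorem similarity_affineSq {r s a b : k} (c : k) (h : r ^ 2 + s ^ 2 ≠ 0)
    (hr : a * r + b * s ≠ 0) :
    similarity r s h (affineSq a b c) = C ((a * r + b * s) ^ 2) *
      affineSq 1 ((b * r - a * s) / (a * r + b * s)) (c / (a * r + b * s)) := by
  have hm : C (σ := Fin 2) (a * r + b * s) * C ((b * r - a * s) / (a * r + b * s)) =
      C (b * r - a * s) := by rw [← C_mul, mul_div_cancel₀ _ hr]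
  have hc : C (σ := Fin 2) (a * r + b * s) * C (c / (a * r + b * s)) = C c := by
    rw [← C_mul, mul_div_cancel₀ _ hr]
  change similarityHom r s _ = _
  simp only [affineSq, map_pow, map_add, map_sub, map_mul, algHom_C, algebraMap_eq,
    similarityHom_X_zero, similarityHom_X_one, map_one, one_mul] at hm hc ⊢
  rw [← mul_pow]
  congr 1
  linear_combination -X 1 * hm - hc

theorem exists_forall_add_mul_ne_zero {ι : Type*} [Finite ι] [Infinite k] {a b : ι → k}
    (hab : ∀ i, a i ≠ 0 ∨ b i ≠ 0) : ∃ t : k, 1 + t ^ 2 ≠ 0 ∧ ∀ i, a i + b i * t ≠ 0 := by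
  let p : Option ι → Polynomial k := fun o => o.elim (1 + Polynomial.X ^ 2) fun i =>
    Polynomial.C (a i) + Polynomial.C (b i) * Polynomial.X
  have hquad : p none ≠ 0 := fun h => by
    simpa [p, Polynomial.coeff_one] using congrArg (Polynomial.coeff · 2) h
  have hlin (i) : p (some i) ≠ 0 := fun h => by
    rcases hab i with ha | hb
    · simpa [p, ha] using congrArg (Polynomial.coeff · 0) h
    · simpa [p, hb, Polynomial.coeff_C] using congrArg (Polynomial.coeff · 1) h
  obtain ⟨t, ht⟩ := exists_forall_eval_ne_zero (Option.forall.2 ⟨hquad, hlin⟩)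
  exact ⟨t, by simpa [p] using ht none, fun i => by simpa [p] using ht (some i)⟩

end Similarity

theorem DirGraph.algEquiv_comp_mem_splLE_iff {V E k : Type*} [Field k] {G : DirGraph V E} {d : ℕ}
    {τ : MvPolynomial (Fin 2) k ≃ₐ[k] MvPolynomial (Fin 2) k}
    (hτ : ∀ p, (τ p).totalDegree ≤ d ↔ p.totalDegree ≤ d) {u : E → k} (hu : ∀ e, u e ≠ 0)
    {l l₁ : E → MvPolynomial (Fin 2) k} (hl : ∀ e, τ (l e) = C (u e) * l₁ e)
    {p : V → MvPolynomial (Fin 2) k} :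
    p ∈ G.splLE l d ↔ (fun v => τ (p v)) ∈ G.splLE l₁ d := by
  simp only [mem_splLE, hτ, ← map_sub]
  refine and_congr_left' (forall_congr' fun e => ?_)
  rw [← map_dvd_iff τ, hl]
  exact (((hu e).isUnit).map C).mul_left_dvd

namespace PlaneGraph

variable {V E k : Type*} [Fintype V] [Fintype E] {G : PlaneGraph V E} [Field k]

theorem FaceTranslatable.of_algEquiv {l l₁ : E → MvPolynomial (Fin 2) k}
    (hG : G.FaceTranslatable l) (τ : MvPolynomial (Fin 2) k ≃ₐ[k] MvPolynomial (Fin 2) k)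
    {u : E → k} (hu : ∀ e, u e ≠ 0) (hl : ∀ e, τ (l e) = C (u e) * l₁ e) :
    G.FaceTranslatable l₁ := by
  intro F
  obtain ⟨x₀, y₀, hF⟩ := hG F
  refine ⟨eval ![x₀, y₀] (τ.symm (X 0)), eval ![x₀, y₀] (τ.symm (X 1)), fun e he => ?_⟩
  have hpoint : ![eval ![x₀, y₀] (τ.symm (X 0)), eval ![x₀, y₀] (τ.symm (X 1))] =
      fun i => eval ![x₀, y₀] (τ.symm (X i)) := List.ofFn_inj.1 rfl
  have hzero := eval_symm_X_algEquiv τ ![x₀, y₀] (l e)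
  rw [hF e he, hl, map_mul, eval_C] at hzero
  rw [hpoint]
  exact (mul_eq_zero.1 hzero).resolve_left (hu e)

theorem FaceTranslatable.exists_normal_form [Infinite k] {a b c : E → k}
    (hab : ∀ e, a e ≠ 0 ∨ b e ≠ 0) (hG : G.FaceTranslatable fun e => affineSq (a e) (b e) (c e)) :
    ∃ (τ : MvPolynomial (Fin 2) k ≃ₐ[k] MvPolynomial (Fin 2) k) (x₀ y₀ : k) (u m s : E → k),
      τ (X 0) = C x₀ * X 0 - C y₀ * X 1 ∧ τ (X 1) = C y₀ * X 0 + C x₀ * X 1 ∧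
      (∀ e, u e ≠ 0) ∧
      (∀ e, τ (affineSq (a e) (b e) (c e)) = C (u e) * affineSq 1 (m e) (s e)) ∧
      (∀ e, τ (affineSq (a e) (b e) 0) = C (u e) * affineSq 1 (m e) 0) ∧
      G.FaceTranslatable (fun e => affineSq 1 (m e) (s e)) ∧
      (∀ (d : ℕ) (p : V → MvPolynomial (Fin 2) k),
        (p ∈ G.splLE (fun e => affineSq (a e) (b e) (c e)) d ↔
          (fun v => τ (p v)) ∈ G.splLE (fun e => affineSq 1 (m e) (s e)) d) ∧
        (p ∈ G.splLE (fun e => affineSq (a e) (b e) 0) d ↔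
          (fun v => τ (p v)) ∈ G.splLE (fun e => affineSq 1 (m e) 0) d)) := by
  obtain ⟨t, ht, hne⟩ := exists_forall_add_mul_ne_zero hab
  have ht' : 1 ^ 2 + t ^ 2 ≠ 0 := by simpa using ht
  let u (e : E) : k := (a e * 1 + b e * t) ^ 2
  have hr (e) : a e * 1 + b e * t ≠ 0 := by simpa using hne e
  have hu (e) : u e ≠ 0 := pow_ne_zero 2 (hr e)
  have hl' (e) := similarity_affineSq (c e) ht' (hr e)
  have hl (e) := similarity_affineSq 0 ht' (hr e)
  simp only [zero_div] at hl
  exact ⟨similarity 1 t ht', 1, t, u, _, _, similarityHom_X_zero 1 t, similarityHom_X_one 1 t, hu,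
    hl', hl, hG.of_algEquiv _ hu hl', fun d p =>
    ⟨DirGraph.algEquiv_comp_mem_splLE_iff (fun _ => totalDegree_similarity_le_iff ht') hu hl',
      DirGraph.algEquiv_comp_mem_splLE_iff (fun _ => totalDegree_similarity_le_iff ht') hu hl⟩⟩

end PlaneGraph

section Cross

/-- Twice the signed area of the triangle with vertices `v`, `w`, `P`; it is positive if `P` lies
to the left of the line from `v` to `w`. -/
def cross (v w P : ℝ × ℝ) : ℝ := (v.1 - P.1) * (w.2 - P.2) - (v.2 - P.2) * (w.1 - P.1)

variable (v w P : ℝ × ℝ)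

theorem cross_rotate : cross w P v = cross v w P := by
  simp only [cross]
  ring

theorem cross_left : cross v w v = 0 := by simp [cross]

theorem cross_right : cross v w w = 0 := by simp [cross]

@[fun_prop]
theorem continuous_cross : Continuous (cross v w) := by
  unfold cross
  fun_prop

theorem cross_combo {r s : ℝ} (h : r + s = 1) (x y : ℝ × ℝ) :
    cross v w (r • x + s • y) = r • cross v w x + s • cross v w y := by
  obtain rfl : s = 1 - r := by linarith
  simp only [cross, Prod.fst_add, Prod.snd_add, Prod.smul_fst, Prod.smul_snd, smul_eq_mul]
  ring

theorem convex_preimage_cross {s : Set ℝ} (hs : Convex ℝ s) : Convex ℝ (cross v w ⁻¹' s) := by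
  intro x hx y hy r t hr ht hrt
  rw [Set.mem_preimage, cross_combo v w hrt]
  exact hs hx hy hr ht hrt

variable {v w P}

theorem cross_eq_zero_of_mem_segment (h : P ∈ segment ℝ v w) : cross v w P = 0 :=
  (convex_preimage_cross v w (convex_singleton 0)).segment_subset (cross_left v w)
    (cross_right v w) h

end Cross

section VisualAngle

open Filter Topology

/-- The identification of the coordinate plane with `ℂ`. -/
noncomputable def toComplex : (ℝ × ℝ) ≃L[ℝ] ℂ := Complex.equivRealProdCLM.symm

/-- The quotient of the complex vectors from `P` to `w` and from `P` to `v`; its argument is the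
angle under which `P` sees the segment from `v` to `w`. It is `0` if `P = v`. -/
noncomputable def visualRatio (v w P : ℝ × ℝ) : ℂ := toComplex (w - P) / toComplex (v - P)

/-- The oriented angle in `(-π, π]` under which `P` sees the segment from `v` to `w`. -/
noncomputable def visualAngle (v w P : ℝ × ℝ) : ℝ := (visualRatio v w P).arg

variable {v w P : ℝ × ℝ}

theorem visualRatio_inv (v w P : ℝ × ℝ) : (visualRatio v w P)⁻¹ = visualRatio w v P := inv_div _ _

theorem toComplex_sub_ne_zero (h : v ≠ w) : toComplex (v - w) ≠ 0 := by
  simpa [sub_eq_zero] using h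

theorem visualRatio_self (h : v ≠ P) : visualRatio v v P = 1 := div_self (toComplex_sub_ne_zero h)

theorem visualRatio_mem_slitPlane (h : P ∉ segment ℝ v w) :
    visualRatio v w P ∈ Complex.slitPlane := by
  have hv : v ≠ P := fun hv => h (hv ▸ left_mem_segment ℝ v w)
  by_contra hslit
  obtain ⟨hre, him⟩ : (visualRatio v w P).re ≤ 0 ∧ (visualRatio v w P).im = 0 := by
    simpa [Complex.mem_slitPlane_iff] using hslit
  obtain ⟨t, ht, hratio⟩ : ∃ t : ℝ, 0 ≤ t ∧ visualRatio v w P = ((-t : ℝ) : ℂ) :=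
    ⟨-(visualRatio v w P).re, neg_nonneg.2 hre, by rw [neg_neg]; exact Complex.ext rfl him⟩
  have hwP : w - P = (-t) • (v - P) := toComplex.injective <| by
    rw [map_smul, Complex.real_smul, ← hratio, visualRatio,
      div_mul_cancel₀ _ (toComplex_sub_ne_zero hv)]
  have hP : (1 + t) • P = t • v + w := by
    rw [← sub_eq_zero, ← sub_eq_zero.2 hwP.symm]
    module
  refine h ⟨t / (1 + t), 1 / (1 + t), by positivity, by positivity, by field_simp; ring, ?_⟩
  rw [← inv_smul_smul₀ (by positivity : 1 + t ≠ 0) P, hP]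
  module

theorem visualAngle_swap (h : P ∉ segment ℝ v w) : visualAngle w v P = -visualAngle v w P := by
  rw [visualAngle, ← visualRatio_inv, Complex.arg_inv,
    if_neg (Complex.slitPlane_arg_ne_pi (visualRatio_mem_slitPlane h)), visualAngle]

theorem continuousAt_visualAngle (h : P ∉ segment ℝ v w) : ContinuousAt (visualAngle v w) P := by
  have hv : v ≠ P := fun hv => h (hv ▸ left_mem_segment ℝ v w)
  refine ContinuousAt.comp (g := Complex.arg)
    (Complex.continuousAt_arg (visualRatio_mem_slitPlane h)) ?_
  exact ContinuousAt.div (by fun_prop) (by fun_prop) (toComplex_sub_ne_zero hv)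

theorem continuousAt_visualAngle_self (h : P ≠ v) :
    ContinuousAt (fun Q => visualAngle P Q v) P := by
  refine ContinuousAt.comp (g := Complex.arg) (f := fun Q => visualRatio P Q v)
    (Complex.continuousAt_arg (by simp [visualRatio_self h])) ?_
  unfold visualRatio
  fun_prop

theorem visualRatio_mul_visualRatio {Q : ℝ × ℝ} (hPv : P ≠ v) (hPw : P ≠ w) (hQv : Q ≠ v) :
    visualRatio v w Q * visualRatio P Q v = visualRatio v w P * visualRatio P Q w := by
  have h₁ := toComplex_sub_ne_zero hPv
  have h₂ := toComplex_sub_ne_zero hPw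
  have h₃ := toComplex_sub_ne_zero hQv
  have hneg (x y : ℝ × ℝ) : toComplex (x - y) = -toComplex (y - x) := by rw [← map_neg, neg_sub]
  simp only [visualRatio, hneg v Q, hneg v P, hneg w Q, hneg w P]
  field_simp

theorem eq_zero_of_coe_angle_eq_zero_of_abs_lt {θ : ℝ} (h : (θ : Real.Angle) = 0)
    (hθ : |θ| < 2 * Real.pi) : θ = 0 := by
  obtain ⟨n, rfl⟩ := Real.Angle.coe_eq_zero_iff.1 h
  rw [zsmul_eq_mul, abs_mul, abs_of_pos Real.two_pi_pos, ← lt_div_iff₀ Real.two_pi_pos,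
    div_self Real.two_pi_pos.ne'] at hθ
  have hn : n = 0 := Int.abs_lt_one_iff.1 (by exact_mod_cast hθ)
  simp [hn]

theorem coe_visualAngle_add {Q : ℝ × ℝ} (hP : P ∉ segment ℝ v w) (hQ : Q ∉ segment ℝ v w) :
    (visualAngle v w Q + visualAngle P Q v : Real.Angle) =
      visualAngle v w P + visualAngle P Q w := by
  have hleft {x : ℝ × ℝ} (hx : x ∉ segment ℝ v w) : x ≠ v :=
    fun hv => hx (hv ▸ left_mem_segment ℝ v w)
  have hright {x : ℝ × ℝ} (hx : x ∉ segment ℝ v w) : x ≠ w :=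
    fun hw => hx (hw ▸ right_mem_segment ℝ v w)
  have hne {x : ℝ × ℝ} (hPx : P ≠ x) (hQx : Q ≠ x) : visualRatio P Q x ≠ 0 :=
    div_ne_zero (toComplex_sub_ne_zero hQx) (toComplex_sub_ne_zero hPx)
  simp only [visualAngle]
  rw [← Complex.arg_mul_coe_angle (Complex.slitPlane_ne_zero (visualRatio_mem_slitPlane hQ))
      (hne (hleft hP) (hleft hQ)),
    ← Complex.arg_mul_coe_angle (Complex.slitPlane_ne_zero (visualRatio_mem_slitPlane hP))
      (hne (hright hP) (hright hQ)),
    visualRatio_mul_visualRatio (hleft hP) (hright hP) (hleft hQ)]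

theorem isClosed_segment (v w : ℝ × ℝ) : IsClosed (segment ℝ v w) := by
  rw [← convexHull_pair]
  exact (Set.toFinite {v, w}).isClosed_convexHull ℝ

/-- As the viewer moves from `P` to a nearby point `Q`, the angle under which a segment is seen
changes by a difference of contributions of its two endpoints. These cancel along cycles. -/
theorem eventually_visualAngle_sub_eq (h : P ∉ segment ℝ v w) :
    ∀ᶠ Q in 𝓝 P,
      visualAngle v w Q - visualAngle v w P = visualAngle P Q w - visualAngle P Q v := by
  have hPv : P ≠ v := fun hv => h (hv ▸ left_mem_segment ℝ v w)
  have hPw : P ≠ w := fun hw => h (hw ▸ right_mem_segment ℝ v w)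
  let δ : ℝ × ℝ → ℝ := fun Q =>
    visualAngle v w Q - visualAngle v w P - (visualAngle P Q w - visualAngle P Q v)
  have hcont : ContinuousAt δ P :=
    ((continuousAt_visualAngle h).sub continuousAt_const).sub
      ((continuousAt_visualAngle_self hPw).sub (continuousAt_visualAngle_self hPv))
  have hδP : δ P = 0 := by simp [δ, visualAngle, visualRatio_self hPv, visualRatio_self hPw]
  have hsmall : ∀ᶠ Q in 𝓝 P, |δ Q| < 2 * Real.pi :=
    hcont.abs.eventually_lt continuousAt_const (by simp [hδP, Real.pi_pos])
  filter_upwards [hsmall, (isClosed_segment v w).isOpen_compl.mem_nhds h] with Q hQ hQoff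
  refine sub_eq_zero.1 (eq_zero_of_coe_angle_eq_zero_of_abs_lt ?_ hQ)
  rw [← sub_eq_zero.2 (coe_visualAngle_add h hQoff)]
  simp only [Real.Angle.coe_sub]
  abel

/-- The point of the perpendicular bisector of the segment from `v` to `w` at signed distance
`ε` times the Euclidean length of the segment, counted positively to the left. -/
noncomputable def sidePoint (v w : ℝ × ℝ) (ε : ℝ) : ℝ × ℝ :=
  ((v.1 + w.1) / 2 - ε * (w.2 - v.2), (v.2 + w.2) / 2 + ε * (w.1 - v.1))

theorem sidePoint_swap (v w : ℝ × ℝ) (ε : ℝ) : sidePoint w v ε = sidePoint v w (-ε) := by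
  ext <;> simp only [sidePoint] <;> ring

@[fun_prop]
theorem continuous_sidePoint (v w : ℝ × ℝ) : Continuous (sidePoint v w) := by
  unfold sidePoint
  fun_prop

theorem sidePoint_zero (v w : ℝ × ℝ) : sidePoint v w 0 = (1 / 2 : ℝ) • v + (1 / 2 : ℝ) • w := by
  ext <;> simp only [sidePoint, Prod.fst_add, Prod.snd_add, Prod.smul_fst, Prod.smul_snd,
    smul_eq_mul] <;> ring

theorem sidePoint_zero_mem_segment (v w : ℝ × ℝ) : sidePoint v w 0 ∈ segment ℝ v w :=
  ⟨1 / 2, 1 / 2, by norm_num, by norm_num, by norm_num, (sidePoint_zero v w).symm⟩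

theorem cross_sidePoint (v w : ℝ × ℝ) (ε : ℝ) :
    cross v w (sidePoint v w ε) = ε * Complex.normSq (toComplex (v - w)) := by
  simp only [cross, sidePoint, toComplex, Complex.normSq_apply, Prod.fst_sub, Prod.snd_sub,
    Complex.equivRealProdCLM_symm_apply_re, Complex.equivRealProdCLM_symm_apply_im]
  ring

theorem cross_sidePoint_pos (h : v ≠ w) {ε : ℝ} (hε : 0 < ε) :
    0 < cross v w (sidePoint v w ε) := by
  rw [cross_sidePoint]
  exact mul_pos hε (Complex.normSq_pos.2 (toComplex_sub_ne_zero h))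

theorem sidePoint_notMem_segment (h : v ≠ w) {ε : ℝ} (hε : 0 < ε) :
    sidePoint v w ε ∉ segment ℝ v w := fun hmem =>
  (cross_sidePoint_pos h hε).ne' (cross_eq_zero_of_mem_segment hmem)

theorem toComplex_sidePoint (v w : ℝ × ℝ) (ε : ℝ) : toComplex (sidePoint v w ε) =
    (toComplex v + toComplex w) / 2 + ε * Complex.I * (toComplex w - toComplex v) := by
  apply Complex.ext <;> simp [toComplex, sidePoint, sub_eq_add_neg]

theorem visualRatio_sidePoint (h : v ≠ w) (ε : ℝ) :
    visualRatio v w (sidePoint v w ε) =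
      (1 - 2 * ε * Complex.I) / (-1 - 2 * ε * Complex.I) := by
  have hw : toComplex (w - sidePoint v w ε) =
      toComplex (w - v) / 2 * (1 - 2 * ε * Complex.I) := by
    rw [map_sub, map_sub, toComplex_sidePoint]
    ring
  have hv : toComplex (v - sidePoint v w ε) =
      toComplex (w - v) / 2 * (-1 - 2 * ε * Complex.I) := by
    rw [map_sub, map_sub, toComplex_sidePoint]
    ring
  rw [visualRatio, hw, hv,
    mul_div_mul_left _ _ (div_ne_zero (toComplex_sub_ne_zero h.symm) two_ne_zero)]

theorem visualRatio_sidePoint_im (h : v ≠ w) (ε : ℝ) :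
    (visualRatio v w (sidePoint v w ε)).im = 4 * ε / (1 + 4 * ε ^ 2) := by
  have hnormSq : Complex.normSq (-1 - 2 * ε * Complex.I) = 1 + 4 * ε ^ 2 := by
    norm_num [Complex.normSq_apply, ← sq, mul_pow]
  have him : (1 - 2 * ε * Complex.I).im * (-1 - 2 * ε * Complex.I).re -
      (1 - 2 * ε * Complex.I).re * (-1 - 2 * ε * Complex.I).im = 4 * ε := by
    norm_num [← two_mul, ← mul_assoc]
  rw [visualRatio_sidePoint h, Complex.div_im, hnormSq, ← sub_div, him]

theorem tendsto_visualAngle_sidePoint (h : v ≠ w) :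
    Tendsto (fun ε => visualAngle v w (sidePoint v w ε)) (𝓝[>] 0) (𝓝 Real.pi) := by
  have hcont : ContinuousAt (fun ε => visualRatio v w (sidePoint v w ε)) 0 := by
    simp only [visualRatio_sidePoint h]
    exact ContinuousAt.div (by fun_prop) (by fun_prop) (by simp)
  have hlim : Tendsto (fun ε => visualRatio v w (sidePoint v w ε)) (𝓝[>] 0) (𝓝 (-1)) := by
    simpa [visualRatio_sidePoint h] using hcont.tendsto.mono_left nhdsWithin_le_nhds
  refine (Complex.tendsto_arg_nhdsWithin_im_nonneg_of_re_neg_of_im_zero (z := -1)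
    (by simp) (by simp)).comp (tendsto_nhdsWithin_iff.2 ⟨hlim, ?_⟩)
  filter_upwards [self_mem_nhdsWithin] with ε (hε : 0 < ε)
  simp only [visualRatio_sidePoint_im h]
  positivity

theorem tendsto_visualAngle_sidePoint_jump (h : v ≠ w) :
    Tendsto (fun ε => visualAngle v w (sidePoint v w ε) - visualAngle v w (sidePoint v w (-ε)))
      (𝓝[>] 0) (𝓝 (2 * Real.pi)) := by
  rw [two_mul]
  refine ((tendsto_visualAngle_sidePoint h).add (tendsto_visualAngle_sidePoint h.symm)).congr' ?_
  filter_upwards [self_mem_nhdsWithin] with ε (hε : 0 < ε)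
  rw [← sidePoint_swap, visualAngle_swap (sidePoint_notMem_segment h.symm hε), sub_neg_eq_add]

end VisualAngle

section PlanarComplex

open Filter Topology

theorem mem_of_mem_convexHull_of_notMem_convexHull_diff {k E : Type*} [Field k] [LinearOrder k]
    [AddCommGroup E] [Module k E] {K : Geometry.SimplicialComplex k E} {s t : Finset E}
    (hs : s ∈ K.faces) (ht : t ∈ K.faces) {P x : E} (hPs : P ∈ convexHull k (s : Set E))
    (hPt : P ∈ convexHull k (t : Set E)) (hPx : P ∉ convexHull k ((s : Set E) \ {x})) : x ∈ t := by
  by_contra hx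
  refine hPx (convexHull_mono ?_ (K.inter_subset_convexHull hs ht ⟨hPs, hPt⟩))
  rintro y ⟨hys, hyt⟩
  exact ⟨hys, fun hyx => hx (hyx ▸ hyt)⟩

/-- The interior of the triangle with vertices `u`, `v`, `w`, which must run counterclockwise
(otherwise the set is empty). -/
def openTriangle (u v w : ℝ × ℝ) : Set (ℝ × ℝ) :=
  {P | 0 < cross u v P ∧ 0 < cross v w P ∧ 0 < cross w u P}

theorem convex_openTriangle (u v w : ℝ × ℝ) : Convex ℝ (openTriangle u v w) :=
  (convex_preimage_cross u v (convex_Ioi 0)).inter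
    ((convex_preimage_cross v w (convex_Ioi 0)).inter (convex_preimage_cross w u (convex_Ioi 0)))

theorem cross_add_cross_add_cross (u v w P : ℝ × ℝ) :
    cross v w P + cross w u P + cross u v P = cross u v w := by
  simp only [cross]
  ring

theorem cross_smul_eq (u v w P : ℝ × ℝ) :
    cross u v w • P = cross v w P • u + cross w u P • v + cross u v P • w := by
  ext <;> simp only [cross, Prod.fst_add, Prod.snd_add, Prod.smul_fst, Prod.smul_snd,
    smul_eq_mul] <;> ring

theorem openTriangle_subset_convexHull (u v w : ℝ × ℝ) :
    openTriangle u v w ⊆ convexHull ℝ {u, v, w} := by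
  rintro P ⟨huv, hvw, hwu⟩
  have hsum := cross_add_cross_add_cross u v w P
  have hP : P = ∑ i, (![cross v w P, cross w u P, cross u v P] i / cross u v w) • ![u, v, w] i := by
    have hpos : cross u v w ≠ 0 := by linarith
    refine smul_right_injective _ hpos ?_
    simp only [cross_smul_eq u v w P, Fin.sum_univ_three, Matrix.cons_val_zero,
      Matrix.cons_val_one, Matrix.cons_val, smul_add, smul_smul, mul_div_cancel₀ _ hpos]
  rw [hP]
  refine (convex_convexHull ℝ _).sum_mem (fun i _ => ?_) ?_ fun i _ => subset_convexHull ℝ _ ?_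
  · have hpos : 0 < cross u v w := by linarith
    fin_cases i <;> dsimp <;> positivity
  · rw [← Finset.sum_div, Fin.sum_univ_three, div_eq_one_iff_eq (by linarith)]
    exact hsum
  · fin_cases i <;> simp

/-- An edge of the complex with a direction. -/
@[ext]
structure OrientedEdge (K : Geometry.SimplicialComplex ℝ (ℝ × ℝ)) where
  source : ℝ × ℝ
  target : ℝ × ℝ
  ne : source ≠ target
  mem_faces : {source, target} ∈ K.faces

/-- A triangle of the complex with a distinguished edge, which is directed counterclockwise. -/
@[ext]
structure OrientedTriangle (K : Geometry.SimplicialComplex ℝ (ℝ × ℝ)) where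
  edge : OrientedEdge K
  apex : ℝ × ℝ
  cross_pos : 0 < cross edge.source edge.target apex
  mem_faces : {edge.source, edge.target, apex} ∈ K.faces

variable {K : Geometry.SimplicialComplex ℝ (ℝ × ℝ)}

variable (K) in
/-- The graph of the vertices and oriented edges of the complex, whose edges come in pairs of
opposite ones. Points of the plane that are not in the complex are isolated vertices. -/
def edgeGraph : DirGraph (ℝ × ℝ) (OrientedEdge K) where
  tail := OrientedEdge.source
  head := OrientedEdge.target

variable (K) in
/-- The points of the plane that lie on no edge. -/
def offEdges : Set (ℝ × ℝ) := {P | ∀ e : OrientedEdge K, P ∉ segment ℝ e.source e.target}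

theorem compl_space_subset_offEdges : K.spaceᶜ ⊆ offEdges K := by
  intro P hP e hseg
  refine hP (Geometry.SimplicialComplex.mem_space_iff.2 ⟨_, e.mem_faces, ?_⟩)
  rwa [Finset.coe_pair, convexHull_pair]

namespace OrientedEdge

/-- The oriented edge between two given vertices of a face. -/
def ofMem {s : Finset (ℝ × ℝ)} (hs : s ∈ K.faces) {v w : ℝ × ℝ} (hv : v ∈ s) (hw : w ∈ s)
    (h : v ≠ w) : OrientedEdge K where
  source := v
  target := w
  ne := h
  mem_faces := K.down_closed hs (by simp [Finset.insert_subset_iff, hv, hw]) (by simp)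

/-- The same edge with the opposite direction. -/
def rev (e : OrientedEdge K) : OrientedEdge K where
  source := e.target
  target := e.source
  ne := e.ne.symm
  mem_faces := Finset.pair_comm e.source e.target ▸ e.mem_faces

theorem rev_involutive : Function.Involutive (rev (K := K)) := fun _ => rfl

theorem rev_ne (e : OrientedEdge K) : e.rev ≠ e := fun h => e.ne (congrArg target h)

variable (e : OrientedEdge K)

theorem source_mem_of_midpoint_mem {s : Finset (ℝ × ℝ)} (hs : s ∈ K.faces)
    (hmid : sidePoint e.source e.target 0 ∈ convexHull ℝ (s : Set (ℝ × ℝ))) : e.source ∈ s := by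
  refine mem_of_mem_convexHull_of_notMem_convexHull_diff e.mem_faces hs ?_ hmid fun h => e.ne ?_
  · rw [Finset.coe_pair, convexHull_pair]
    exact sidePoint_zero_mem_segment _ _
  · have htarget : sidePoint e.source e.target 0 = e.target := by
      simpa [Set.insert_sdiff_of_mem, Set.sdiff_singleton_eq_self, e.ne] using h
    rw [sidePoint_zero] at htarget
    have : (1 / 2 : ℝ) • e.source = (1 / 2 : ℝ) • e.target := by
      rw [← sub_eq_zero, ← sub_eq_zero.2 htarget]
      module
    exact smul_right_injective _ (by norm_num) this

theorem target_mem_of_midpoint_mem {s : Finset (ℝ × ℝ)} (hs : s ∈ K.faces)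
    (hmid : sidePoint e.source e.target 0 ∈ convexHull ℝ (s : Set (ℝ × ℝ))) : e.target ∈ s :=
  e.rev.source_mem_of_midpoint_mem hs <| by
    simpa only [rev, sidePoint_swap e.source e.target, neg_zero] using hmid

theorem eq_or_eq_rev_of_midpoint_mem {e e' : OrientedEdge K}
    (hmid : sidePoint e.source e.target 0 ∈ segment ℝ e'.source e'.target) :
    e' = e ∨ e' = e.rev := by
  rw [← convexHull_pair, ← Finset.coe_pair] at hmid
  have hs := e.source_mem_of_midpoint_mem e'.mem_faces hmid
  have ht := e.target_mem_of_midpoint_mem e'.mem_faces hmid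
  simp only [Finset.mem_insert, Finset.mem_singleton] at hs ht
  have hne := e.ne
  rw [OrientedEdge.ext_iff, OrientedEdge.ext_iff, rev]
  grind

end OrientedEdge

namespace OrientedTriangle

variable (t : OrientedTriangle K)

theorem target_ne_apex : t.edge.target ≠ t.apex := fun h =>
  t.cross_pos.ne' (h ▸ cross_right _ _)

theorem apex_ne_source : t.apex ≠ t.edge.source := fun h =>
  t.cross_pos.ne' (h ▸ cross_left _ _)

/-- The same triangle, with the next edge distinguished. -/
noncomputable def rotate (t : OrientedTriangle K) : OrientedTriangle K where
  edge := .ofMem t.mem_faces (v := t.edge.target) (w := t.apex) (by simp) (by simp) t.target_ne_apex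
  apex := t.edge.source
  cross_pos := (cross_rotate _ _ _).symm ▸ t.cross_pos
  mem_faces := by
    convert t.mem_faces using 1
    ext x
    simp only [OrientedEdge.ofMem, Finset.mem_insert, Finset.mem_singleton]
    tauto

theorem rotate_bijective : Function.Bijective (rotate (K := K)) :=
  Function.bijective_iff_has_inverse.2 ⟨fun t => t.rotate.rotate, fun _ => rfl, fun _ => rfl⟩

/-- The interior of the triangle. -/
def interior : Set (ℝ × ℝ) := openTriangle t.edge.source t.edge.target t.apex

/-- The centroid of the triangle. -/
noncomputable def centroid : ℝ × ℝ := (1 / 3 : ℝ) • (t.edge.source + t.edge.target + t.apex)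

theorem interior_rotate : t.rotate.interior = t.interior := by
  ext P
  exact ⟨fun ⟨h₁, h₂, h₃⟩ => ⟨h₃, h₁, h₂⟩, fun ⟨h₁, h₂, h₃⟩ => ⟨h₂, h₃, h₁⟩⟩

theorem centroid_rotate : t.rotate.centroid = t.centroid := by
  simp only [centroid, rotate, OrientedEdge.ofMem, add_comm, add_left_comm]

theorem centroid_mem_interior : t.centroid ∈ t.interior := by
  have hcross (u v w : ℝ × ℝ) : cross u v ((1 / 3 : ℝ) • (u + v + w)) = cross u v w / 3 := by
    simp only [cross, Prod.smul_fst, Prod.smul_snd, Prod.fst_add, Prod.snd_add, smul_eq_mul]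
    ring
  have hpos (t : OrientedTriangle K) : 0 < cross t.edge.source t.edge.target t.centroid := by
    rw [centroid, hcross]
    exact div_pos t.cross_pos three_pos
  exact ⟨hpos t, t.centroid_rotate ▸ hpos t.rotate,
    t.centroid_rotate ▸ t.rotate.centroid_rotate ▸ hpos t.rotate.rotate⟩

theorem interior_subset_convexHull : t.interior ⊆
    convexHull ℝ (({t.edge.source, t.edge.target, t.apex} : Finset (ℝ × ℝ)) : Set (ℝ × ℝ)) := by
  simpa [interior] using openTriangle_subset_convexHull t.edge.source t.edge.target t.apex

variable {t} {s : Finset (ℝ × ℝ)} {P : ℝ × ℝ}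

theorem apex_mem_of_mem_interior (hP : P ∈ t.interior) (hs : s ∈ K.faces)
    (hPs : P ∈ convexHull ℝ (s : Set (ℝ × ℝ))) : t.apex ∈ s := by
  refine mem_of_mem_convexHull_of_notMem_convexHull_diff t.mem_faces hs
    (t.interior_subset_convexHull hP) hPs fun hseg => hP.1.ne' (cross_eq_zero_of_mem_segment ?_)
  rw [← convexHull_pair]
  refine convexHull_mono ?_ hseg
  rintro x ⟨hx, hxa⟩
  simpa [Set.notMem_singleton_iff.1 hxa] using hx

theorem mem_of_mem_interior (hP : P ∈ t.interior) (hs : s ∈ K.faces)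
    (hPs : P ∈ convexHull ℝ (s : Set (ℝ × ℝ))) :
    t.edge.source ∈ s ∧ t.edge.target ∈ s ∧ t.apex ∈ s :=
  ⟨apex_mem_of_mem_interior (t := t.rotate) (by rwa [interior_rotate]) hs hPs,
    apex_mem_of_mem_interior (t := t.rotate.rotate) (by rwa [interior_rotate, interior_rotate]) hs
      hPs,
    apex_mem_of_mem_interior hP hs hPs⟩

theorem interior_subset_offEdges : t.interior ⊆ offEdges K := by
  intro P hP e hseg
  obtain ⟨hu, hv, hw⟩ := mem_of_mem_interior hP e.mem_faces
    (by rwa [Finset.coe_pair, convexHull_pair])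
  have huv := t.edge.ne
  have hvw := t.target_ne_apex
  have hwu := t.apex_ne_source
  simp only [Finset.mem_insert, Finset.mem_singleton] at hu hv hw
  grind

variable (t) in
theorem eventually_sidePoint_mem_interior :
    ∀ᶠ ε in 𝓝[>] 0, sidePoint t.edge.source t.edge.target ε ∈ t.interior := by
  set v := t.edge.source
  set w := t.edge.target
  have hmid₁ : 0 < cross w t.apex (sidePoint v w 0) := by
    rw [sidePoint_zero, cross_combo _ _ (by norm_num), cross_left, cross_rotate v w]
    simpa using t.cross_pos
  have hmid₂ : 0 < cross t.apex v (sidePoint v w 0) := by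
    rw [sidePoint_zero, cross_combo _ _ (by norm_num), cross_right, cross_rotate w, cross_rotate v]
    simpa using t.cross_pos
  have hnear {x y : ℝ × ℝ} (h : 0 < cross x y (sidePoint v w 0)) :
      ∀ᶠ ε in 𝓝[>] 0, 0 < cross x y (sidePoint v w ε) :=
    nhdsWithin_le_nhds <| ((continuous_cross x y).comp
      (continuous_sidePoint v w)).continuousAt.eventually_const_lt h
  filter_upwards [self_mem_nhdsWithin, hnear hmid₁, hnear hmid₂] with ε hε h₁ h₂
  exact ⟨cross_sidePoint_pos t.edge.ne hε, h₁, h₂⟩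

theorem edge_injective : Function.Injective (edge (K := K)) := by
  intro t t' h
  obtain ⟨ε, hε, hε'⟩ :=
    (t.eventually_sidePoint_mem_interior.and t'.eventually_sidePoint_mem_interior).exists
  rw [h] at hε
  have hapex := apex_mem_of_mem_interior hε t'.mem_faces (t'.interior_subset_convexHull hε')
  rw [← h] at hapex
  simp only [Finset.mem_insert, Finset.mem_singleton] at hapex
  have hne := t.target_ne_apex
  have hne' := t.apex_ne_source
  exact OrientedTriangle.ext h (by grind)

end OrientedTriangle

namespace OrientedEdge

variable {e : OrientedEdge K}

theorem cross_nonpos_of_forall_edge_ne (h : ∀ t : OrientedTriangle K, t.edge ≠ e)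
    {s : Finset (ℝ × ℝ)} (hs : s ∈ K.faces) (hsource : e.source ∈ s) (htarget : e.target ∈ s)
    {x : ℝ × ℝ} (hx : x ∈ convexHull ℝ (s : Set (ℝ × ℝ))) : cross e.source e.target x ≤ 0 := by
  refine convexHull_min (s := (s : Set (ℝ × ℝ))) (fun y hy => ?_)
    (convex_preimage_cross e.source e.target (convex_Iic 0)) hx
  by_contra! hpos
  refine h ⟨e, y, not_le.1 hpos, K.down_closed hs ?_ (by simp)⟩ rfl
  simpa [Finset.insert_subset_iff, hsource, htarget] using hy

theorem eventually_sidePoint_notMem_convexHull (h : ∀ t : OrientedTriangle K, t.edge ≠ e)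
    {s : Finset (ℝ × ℝ)} (hs : s ∈ K.faces) :
    ∀ᶠ ε in 𝓝[>] 0, sidePoint e.source e.target ε ∉ convexHull ℝ (s : Set (ℝ × ℝ)) := by
  by_cases hmid : sidePoint e.source e.target 0 ∈ convexHull ℝ (s : Set (ℝ × ℝ))
  · filter_upwards [self_mem_nhdsWithin] with ε hε hmem
    exact (cross_sidePoint_pos e.ne hε).not_ge (cross_nonpos_of_forall_edge_ne h hs
      (e.source_mem_of_midpoint_mem hs hmid) (e.target_mem_of_midpoint_mem hs hmid) hmem)
  · exact nhdsWithin_le_nhds ((continuous_sidePoint _ _).continuousAt.eventually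
      ((s.finite_toSet.isClosed_convexHull ℝ).isOpen_compl.mem_nhds hmid))

theorem eventually_sidePoint_mem_compl_space (hfin : K.faces.Finite)
    (h : ∀ t : OrientedTriangle K, t.edge ≠ e) :
    ∀ᶠ ε in 𝓝[>] 0, sidePoint e.source e.target ε ∈ K.spaceᶜ := by
  filter_upwards [hfin.eventually_all.2 fun s hs => eventually_sidePoint_notMem_convexHull h hs]
    with ε hε hmem
  obtain ⟨s, hs, hmem⟩ := Geometry.SimplicialComplex.mem_space_iff.1 hmem
  exact hε s hs hmem

end OrientedEdge

end PlanarComplex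

section Winding

open Filter Topology

variable {K : Geometry.SimplicialComplex ℝ (ℝ × ℝ)} {c : OrientedEdge K →₀ ℝ}

/-- The total angle under which `P` sees the chain `c`, that is, `2π` times the winding number
around `P` if `c` is a cycle. -/
noncomputable def winding (c : OrientedEdge K →₀ ℝ) (P : ℝ × ℝ) : ℝ :=
  Finsupp.linearCombination ℝ (fun e : OrientedEdge K => visualAngle e.source e.target P) c

theorem winding_sub_winding (c : OrientedEdge K →₀ ℝ) (P Q : ℝ × ℝ) :
    winding c P - winding c Q = Finsupp.linearCombination ℝ (fun e : OrientedEdge K =>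
      visualAngle e.source e.target P - visualAngle e.source e.target Q) c := by
  simp only [winding, Finsupp.linearCombination_apply, smul_sub, Finsupp.sum_sub]

theorem eventually_winding_eq (hc : (edgeGraph K).boundary ℝ c = 0) {P : ℝ × ℝ}
    (hP : P ∈ offEdges K) : ∀ᶠ Q in 𝓝 P, winding c Q = winding c P := by
  filter_upwards [c.support.eventually_all.2 fun e _ => eventually_visualAngle_sub_eq (hP e)]
    with Q hQ
  have hboundary := (edgeGraph K).linearCombination_boundary (visualAngle P Q) c
  rw [hc, map_zero] at hboundary
  rw [← sub_eq_zero, winding_sub_winding, hboundary, Finsupp.linearCombination_apply,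
    Finsupp.linearCombination_apply]
  exact Finsupp.sum_congr fun e he => congrArg (c e • ·) (hQ e he)

theorem winding_eq_of_isPreconnected (hc : (edgeGraph K).boundary ℝ c = 0) {A : Set (ℝ × ℝ)}
    (hA : IsPreconnected A) (hsub : A ⊆ offEdges K) {P Q : ℝ × ℝ} (hP : P ∈ A) (hQ : Q ∈ A) :
    winding c P = winding c Q := by
  have : PreconnectedSpace A := Subtype.preconnectedSpace hA
  have hloc : IsLocallyConstant fun x : A => winding c x :=
    (IsLocallyConstant.iff_eventually_eq _).2 fun x =>
      continuous_subtype_val.continuousAt.eventually (eventually_winding_eq hc (hsub x.2))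
  exact hloc.apply_eq_of_preconnectedSpace ⟨P, hP⟩ ⟨Q, hQ⟩

theorem tendsto_visualAngle_jump (e e' : OrientedEdge K) :
    Tendsto (fun ε => visualAngle e'.source e'.target (sidePoint e.source e.target ε) -
        visualAngle e'.source e'.target (sidePoint e.source e.target (-ε))) (𝓝[>] 0)
      (𝓝 (2 * Real.pi *
        (Finsupp.single e 1 - Finsupp.single e.rev 1 : OrientedEdge K →₀ ℝ) e')) := by
  by_cases hmid : sidePoint e.source e.target 0 ∈ segment ℝ e'.source e'.target
  · rcases OrientedEdge.eq_or_eq_rev_of_midpoint_mem hmid with rfl | rfl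
    · simpa [e'.rev_ne.symm] using tendsto_visualAngle_sidePoint_jump e'.ne
    · have hcoeff :
          (Finsupp.single e 1 - Finsupp.single e.rev 1 : OrientedEdge K →₀ ℝ) e.rev = -1 := by
        simp [e.rev_ne.symm]
      rw [hcoeff, mul_neg_one]
      refine (tendsto_visualAngle_sidePoint_jump e.rev.ne).neg.congr fun ε => ?_
      simp only [OrientedEdge.rev, sidePoint_swap e.source e.target, neg_neg, neg_sub]
  · have hne : e ≠ e' := by
      rintro rfl
      exact hmid (sidePoint_zero_mem_segment _ _)
    have hne_rev : e.rev ≠ e' := by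
      rintro rfl
      exact hmid (segment_symm ℝ e.source e.target ▸ sidePoint_zero_mem_segment _ _)
    have hcont : ContinuousAt (visualAngle e'.source e'.target) (sidePoint e.source e.target 0) :=
      continuousAt_visualAngle hmid
    have hplus := hcont.tendsto.comp ((continuous_sidePoint e.source e.target).tendsto 0)
    have hminus := hcont.tendsto.comp
      (((continuous_sidePoint e.source e.target).comp continuous_neg).tendsto' 0 _ (by simp))
    simpa [hne, hne_rev] using (hplus.sub hminus).mono_left nhdsWithin_le_nhds

theorem tendsto_winding_jump (c : OrientedEdge K →₀ ℝ) (e : OrientedEdge K) :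
    Tendsto (fun ε => winding c (sidePoint e.source e.target ε) -
        winding c (sidePoint e.source e.target (-ε))) (𝓝[>] 0)
      (𝓝 (2 * Real.pi * (c e - c e.rev))) := by
  have hlim : 2 * Real.pi * (c e - c e.rev) = ∑ e' ∈ c.support, c e' *
      (2 * Real.pi * (Finsupp.single e 1 - Finsupp.single e.rev 1 : OrientedEdge K →₀ ℝ) e') := by
    classical
    have hcoeff (e₀ : OrientedEdge K) : ∑ e' ∈ c.support, c e' * Finsupp.single e₀ 1 e' = c e₀ := by
      simp +contextual [Finsupp.single_apply, eq_comm]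
    simp only [Finsupp.sub_apply, mul_left_comm (c _), mul_sub, ← Finset.mul_sum,
      Finset.sum_sub_distrib, hcoeff]
  simp only [winding_sub_winding, Finsupp.linearCombination_apply, Finsupp.sum, smul_eq_mul, hlim]
  exact tendsto_finsetSum _ fun e' _ => (tendsto_visualAngle_jump e e').const_mul _

/-- The function that maps an edge to the winding number (times `2π`) of `c` around the triangle to
its left, relative to that around `O`, and to `0` if there is no triangle to its left. -/
noncomputable def leftWinding (c : OrientedEdge K →₀ ℝ) (O : ℝ × ℝ) : OrientedEdge K → ℝ :=
  Function.extend OrientedTriangle.edge (fun t => winding c t.centroid - winding c O) 0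

theorem eventually_winding_sidePoint_eq_leftWinding (hfin : K.faces.Finite)
    (hconn : IsPreconnected K.spaceᶜ) (hc : (edgeGraph K).boundary ℝ c = 0) {O : ℝ × ℝ}
    (hO : O ∈ K.spaceᶜ) (e : OrientedEdge K) :
    ∀ᶠ ε in 𝓝[>] 0,
      winding c (sidePoint e.source e.target ε) - winding c O = leftWinding c O e := by
  by_cases h : ∃ t : OrientedTriangle K, t.edge = e
  · obtain ⟨t, rfl⟩ := h
    filter_upwards [t.eventually_sidePoint_mem_interior] with ε hε
    rw [leftWinding, OrientedTriangle.edge_injective.extend_apply,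
      winding_eq_of_isPreconnected hc (convex_openTriangle _ _ _).isPreconnected
        OrientedTriangle.interior_subset_offEdges hε t.centroid_mem_interior]
  · rw [leftWinding, Function.extend_apply' _ _ _ h]
    filter_upwards [OrientedEdge.eventually_sidePoint_mem_compl_space hfin (not_exists.1 h)]
      with ε hε
    rw [winding_eq_of_isPreconnected hc hconn compl_space_subset_offEdges hε hO, sub_self,
      Pi.zero_apply]

/-- Both sides are the jump of the total visual angle of `c` across `e`. -/
theorem two_pi_mul_sub_eq_leftWinding_sub (hfin : K.faces.Finite)
    (hconn : IsPreconnected K.spaceᶜ) (hc : (edgeGraph K).boundary ℝ c = 0) {O : ℝ × ℝ}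
    (hO : O ∈ K.spaceᶜ) (e : OrientedEdge K) :
    2 * Real.pi * (c e - c e.rev) = leftWinding c O e - leftWinding c O e.rev := by
  refine tendsto_nhds_unique (tendsto_winding_jump c e) (tendsto_const_nhds.congr' ?_)
  filter_upwards [eventually_winding_sidePoint_eq_leftWinding hfin hconn hc hO e,
    eventually_winding_sidePoint_eq_leftWinding hfin hconn hc hO e.rev] with ε hε hε_rev
  rw [← hε, ← hε_rev, ← sidePoint_swap, sub_sub_sub_cancel_right]
  rfl

variable {W : Type*} [AddCommGroup W] [Module ℝ W] {ω : OrientedEdge K → W}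

theorem sum_sub_rev_smul_eq_two_smul_sum [Fintype (OrientedEdge K)]
    (hanti : ∀ e, ω e.rev = -ω e) (f : OrientedEdge K → ℝ) :
    ∑ e, (f e - f e.rev) • ω e = (2 : ℝ) • ∑ e, f e • ω e := by
  have hrev : ∑ e : OrientedEdge K, f e.rev • ω e = -∑ e, f e • ω e := by
    rw [← OrientedEdge.rev_involutive.bijective.sum_comp (fun e => f e • ω e)]
    simp [hanti]
  simp only [sub_smul, Finset.sum_sub_distrib, hrev]
  module

theorem sum_smul_edge_eq_zero [Fintype (OrientedTriangle K)]
    (hclosed : ∀ t : OrientedTriangle K,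
      ω t.edge + ω t.rotate.edge + ω t.rotate.rotate.edge = 0)
    {g : OrientedTriangle K → ℝ} (hg : ∀ t, g t.rotate = g t) : ∑ t, g t • ω t.edge = 0 := by
  have hrot (F : OrientedTriangle K → W) : ∑ t : OrientedTriangle K, F t.rotate = ∑ t, F t :=
    OrientedTriangle.rotate_bijective.sum_comp F
  have hthree : (3 : ℝ) • ∑ t, g t • ω t.edge = 0 :=
    calc (3 : ℝ) • ∑ t, g t • ω t.edge
        = ∑ t, g t • ω t.edge + ∑ t, g t • ω t.rotate.edge +
            ∑ t, g t • ω t.rotate.rotate.edge := by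
          have h₁ := hrot fun t => g t • ω t.edge
          have h₂ := hrot fun t => g t • ω t.rotate.edge
          simp only [hg] at h₁ h₂
          rw [h₂, h₁]
          module
      _ = 0 := by simp only [← Finset.sum_add_distrib, ← smul_add, hclosed, smul_zero,
          Finset.sum_const_zero]
  simpa using hthree

theorem finite_vertices (hfin : K.faces.Finite) : Finite K.vertices :=
  hfin.preimage Finset.singleton_injective.injOn

theorem mem_vertices_of_mem {s : Finset (ℝ × ℝ)} (hs : s ∈ K.faces) {v : ℝ × ℝ} (hv : v ∈ s) :
    v ∈ K.vertices :=
  K.down_closed hs (Finset.singleton_subset_iff.2 hv) (by simp)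

theorem finite_orientedEdge (hfin : K.faces.Finite) : Finite (OrientedEdge K) := by
  have := finite_vertices hfin
  refine Finite.of_injective (β := K.vertices × K.vertices)
    (fun e => (⟨e.source, mem_vertices_of_mem e.mem_faces (by simp)⟩,
      ⟨e.target, mem_vertices_of_mem e.mem_faces (by simp)⟩)) fun e e' h => ?_
  simpa [OrientedEdge.ext_iff] using h

theorem sum_leftWinding_smul_eq_zero [Fintype (OrientedEdge K)] (hclosed : ∀ t : OrientedTriangle K,
      ω t.edge + ω t.rotate.edge + ω t.rotate.rotate.edge = 0) (c : OrientedEdge K →₀ ℝ)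
    (O : ℝ × ℝ) : ∑ e, leftWinding c O e • ω e = 0 := by
  have := Fintype.ofInjective _ (OrientedTriangle.edge_injective (K := K))
  rw [← sum_smul_edge_eq_zero hclosed (g := fun t => winding c t.centroid - winding c O)
    fun t => by rw [t.centroid_rotate]]
  refine (Fintype.sum_of_injective _ OrientedTriangle.edge_injective _ _ (fun e he => ?_)
    fun t => ?_).symm
  · rw [leftWinding, Function.extend_apply' _ _ _ he, Pi.zero_apply, zero_smul]
  · rw [leftWinding, OrientedTriangle.edge_injective.extend_apply]

/-- A planar complex without holes has no first cohomology: a cycle is `(2π)⁻¹` times the boundary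
of the chain of triangles whose coefficients are its winding numbers around them. -/
theorem isExact_edgeGraph_of_closed (hfin : K.faces.Finite) (hconn : IsConnected K.spaceᶜ)
    (hanti : ∀ e, ω e.rev = -ω e)
    (hclosed : ∀ t : OrientedTriangle K,
      ω t.edge + ω t.rotate.edge + ω t.rotate.rotate.edge = 0) :
    (edgeGraph K).IsExact ω := by
  have := finite_orientedEdge hfin
  have := Fintype.ofFinite (OrientedEdge K)
  obtain ⟨O, hO⟩ := hconn.nonempty
  refine DirGraph.isExact_of_ker_boundary_le (k := ℝ) fun c hc => ?_
  rw [LinearMap.mem_ker, Finsupp.linearCombination_apply, Finsupp.sum_fintype _ _ (by simp)]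
  have hzero : (2 * Real.pi) • (2 : ℝ) • ∑ e, c e • ω e = 0 :=
    calc (2 * Real.pi) • (2 : ℝ) • ∑ e, c e • ω e
        = ∑ e, (leftWinding c O e - leftWinding c O e.rev) • ω e := by
          rw [← sum_sub_rev_smul_eq_two_smul_sum hanti, Finset.smul_sum]
          simp only [smul_smul,
            two_pi_mul_sub_eq_leftWinding_sub hfin hconn.isPreconnected hc hO]
      _ = 0 := by rw [sum_sub_rev_smul_eq_two_smul_sum hanti,
          sum_leftWinding_smul_eq_zero hclosed, smul_zero]
  simpa [Real.pi_ne_zero] using hzero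

end Winding

namespace PlanarTriangulation

variable {Δ : PlanarTriangulation}

theorem exists_triangle_superset {s : Finset (ℝ × ℝ)} (hs : s ∈ Δ.complex.faces) :
    ∃ t : Δ.Triangle, s ⊆ t.1 :=
  let ⟨t, ht, hst, hcard⟩ := Δ.pure s hs
  ⟨⟨t, ht, hcard⟩, hst⟩

theorem dualGraph_adj_of_mem {t t' : Δ.Triangle} (htt : t ≠ t') {v w : ℝ × ℝ} (hvw : v ≠ w)
    (hv : v ∈ t.1) (hw : w ∈ t.1) (hv' : v ∈ t'.1) (hw' : w ∈ t'.1) : Δ.dualGraph.Adj t t' :=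
  ⟨htt, {v, w}, (OrientedEdge.ofMem t.2.1 hv hw hvw).mem_faces, Finset.card_pair hvw,
    by simp [Finset.insert_subset_iff, hv, hw], by simp [Finset.insert_subset_iff, hv', hw']⟩

theorem exists_forall_sub_eq_sub {W : Type*} [AddCommGroup W] [Module ℝ W]
    {F : Δ.Triangle → ℝ × ℝ → W}
    (hF : ∀ t t', Δ.dualGraph.Adj t t' → ∀ v w, v ∈ t.1 → w ∈ t.1 → v ∈ t'.1 → w ∈ t'.1 →
      F t w - F t v = F t' w - F t' v) :
    ∃ r : ℝ × ℝ → W, ∀ t, ∀ v ∈ t.1, ∀ w ∈ t.1, r w - r v = F t w - F t v := by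
  choose T hT using fun e : OrientedEdge Δ.complex => exists_triangle_superset e.mem_faces
  let ω (e : OrientedEdge Δ.complex) : W := F (T e) e.target - F (T e) e.source
  have hω {e : OrientedEdge Δ.complex} {t : Δ.Triangle} (hsource : e.source ∈ t.1)
      (htarget : e.target ∈ t.1) : ω e = F t e.target - F t e.source := by
    have hsource' : e.source ∈ (T e).1 := hT e (by simp)
    have htarget' : e.target ∈ (T e).1 := hT e (by simp)
    rcases eq_or_ne (T e) t with rfl | hne
    · rfl
    · exact hF _ _ (dualGraph_adj_of_mem hne e.ne hsource' htarget' hsource htarget) _ _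
        hsource' htarget' hsource htarget
  have hanti (e : OrientedEdge Δ.complex) : ω e.rev = -ω e := by
    rw [hω (e := e.rev) (t := T e) (hT e (by simp [OrientedEdge.rev]))
      (hT e (by simp [OrientedEdge.rev]))]
    exact (neg_sub _ _).symm
  have hclosed (s : OrientedTriangle Δ.complex) :
      ω s.edge + ω s.rotate.edge + ω s.rotate.rotate.edge = 0 := by
    obtain ⟨t, ht⟩ := exists_triangle_superset s.mem_faces
    have hu : s.edge.source ∈ t.1 := ht (by simp)
    have hv : s.edge.target ∈ t.1 := ht (by simp)
    have hw : s.apex ∈ t.1 := ht (by simp)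
    rw [hω hu hv, hω (e := s.rotate.edge) hv hw, hω (e := s.rotate.rotate.edge) hw hu]
    simp only [OrientedTriangle.rotate, OrientedEdge.ofMem]
    abel
  obtain ⟨r, hr⟩ := isExact_edgeGraph_of_closed Δ.finite Δ.no_holes hanti hclosed
  refine ⟨r, fun t v hv w hw => ?_⟩
  rcases eq_or_ne v w with rfl | hvw
  · simp only [sub_self]
  · exact (hr (.ofMem t.2.1 hv hw hvw)).trans (hω hv hw)

namespace IsDirectedDual

variable {G : DirGraph Δ.Triangle Δ.dualGraph.edgeSet}

theorem exists_edge (hG : Δ.IsDirectedDual G) {t t' : Δ.Triangle} (h : Δ.dualGraph.Adj t t') :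
    ∃ e, (G.tail e = t ∧ G.head e = t') ∨ (G.tail e = t' ∧ G.head e = t) :=
  ⟨⟨s(t, t'), h⟩, by simpa using hG ⟨s(t, t'), h⟩⟩

theorem isConnected (hG : Δ.IsDirectedDual G) : G.IsConnected := by
  refine ⟨?_, fun t t' => ?_⟩
  · obtain ⟨s, hs⟩ := Δ.nonempty
    exact (exists_triangle_superset hs).nonempty
  · induction Δ.edge_connected t t' with
    | refl => exact .refl _
    | @tail t' t'' _ hshare ih =>
      refine .trans _ _ _ ih ?_
      rcases eq_or_ne t' t'' with rfl | hne
      · exact .refl _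
      · obtain ⟨e, he | he⟩ := hG.exists_edge ⟨hne, hshare⟩
        · exact .rel _ _ ⟨e, he⟩
        · exact .symm _ _ (.rel _ _ ⟨e, he⟩)

theorem exists_mem_tail_mem_head (hG : Δ.IsDirectedDual G) (e : Δ.dualGraph.edgeSet) :
    ∃ v, v ∈ (G.tail e).1 ∧ v ∈ (G.head e).1 := by
  have hadj : Δ.dualGraph.Adj (G.tail e) (G.head e) := by
    rw [← SimpleGraph.mem_edgeSet, hG e]
    exact e.2
  obtain ⟨-, s, hs, -, htail, hhead⟩ := hadj
  obtain ⟨v, hv⟩ := Δ.complex.nonempty_of_mem_faces hs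
  exact ⟨v, htail hv, hhead hv⟩

theorem isExact_of_forall_sub_eq {W : Type*} [AddCommGroup W] [Module ℝ W] (hG : Δ.IsDirectedDual G)
    {F : Δ.Triangle → ℝ × ℝ → W} {f : Δ.dualGraph.edgeSet → W}
    (hF : ∀ e, ∀ v, v ∈ (G.tail e).1 → v ∈ (G.head e).1 → F (G.head e) v - F (G.tail e) v = f e) :
    G.IsExact f := by
  obtain ⟨r, hr⟩ := exists_forall_sub_eq_sub (F := F) fun t t' hadj v w hv hw hv' hw' => by
    obtain ⟨e, ⟨rfl, rfl⟩ | ⟨rfl, rfl⟩⟩ := hG.exists_edge hadj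
    · rw [sub_eq_sub_iff_sub_eq_sub, ← neg_inj, neg_sub, neg_sub, hF e w hw hw', hF e v hv hv']
    · rw [sub_eq_sub_iff_sub_eq_sub, hF e w hw' hw, hF e v hv' hv]
  have hconst (t : Δ.Triangle) {v w : ℝ × ℝ} (hv : v ∈ t.1) (hw : w ∈ t.1) :
      F t v - r v = F t w - r w := by
    linear_combination (norm := abel) hr t v hv w hw
  choose x hx using fun t : Δ.Triangle => Δ.complex.nonempty_of_mem_faces t.2.1
  refine ⟨fun t => F t (x t) - r (x t), fun e => ?_⟩
  obtain ⟨v, htail, hhead⟩ := hG.exists_mem_tail_mem_head e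
  simp only [hconst _ (hx _) hhead, hconst _ (hx _) htail, sub_sub_sub_cancel_right,
    hF e v htail hhead]

variable {𝕜 : Type*} [Field 𝕜] [Algebra ℝ 𝕜] {a b c z : Δ.dualGraph.edgeSet → 𝕜}

theorem isExact_of_isExact_zero (hG : Δ.IsDirectedDual G)
    (hline : ∀ e, ∀ P : ℝ × ℝ, P ∈ (G.tail e).1 → P ∈ (G.head e).1 →
      a e * algebraMap ℝ 𝕜 P.1 + b e * algebraMap ℝ 𝕜 P.2 + c e = 0)
    (hz : G.IsExact fun e => C (z e) * affineSq (a e) (b e) 0) :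
    G.IsExact fun e => C (z e) * affineSq (a e) (b e) (c e) := by
  obtain ⟨q, hq⟩ := hz
  refine hG.isExact_of_forall_sub_eq (F := fun t P =>
    polyTranslate ![algebraMap ℝ 𝕜 P.1, algebraMap ℝ 𝕜 P.2] (q t)) fun e P htail hhead => ?_
  rw [← map_sub, hq, map_mul, polyTranslate_affineSq_zero (by simpa using hline e P htail hhead),
    algHom_C, algebraMap_eq]

end IsDirectedDual

end PlanarTriangulation

theorem mainTheorem4_general (𝕜 : Type*) [Field 𝕜] [Infinite 𝕜] (h2 : (2 : 𝕜) ≠ 0) :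
    (∀ (V E : Type*) [Fintype V] [Fintype E] (G : PlaneGraph V E) (a b c : E → 𝕜)
      (l' l : E → MvPolynomial (Fin 2) 𝕜),
      (∀ e, a e ≠ 0 ∨ b e ≠ 0) →
      (∀ e, l' e = affineSq (a e) (b e) (c e)) →
      (∀ e, l e = affineSq (a e) (b e) 0) →
      G.FaceTranslatable l' →
      (G.cofactor l' '' (G.splLE l' 2 : Set (V → MvPolynomial (Fin 2) 𝕜)) =
        {f | ∃ z : E → 𝕜, (G.extMatrix a b).mulVec z = 0 ∧ ∀ e, f e = C (z e)}) ∧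
      (∀ v₀ : V,
        (∃ Ψ : G.splLEAt l' 2 v₀ ≃ₗ[𝕜] G.splHomAt l 2 v₀,
          ∀ p, G.cofactor l (Ψ p).1 = G.cofactor l' p.1) ∧
        G.splLEAt l 2 v₀ = G.splHomAt l 2 v₀) ∧
      Nonempty (G.splLE l' 2 ≃ₗ[𝕜] G.splLE l 2) ∧
      (∃ (τ : MvPolynomial (Fin 2) 𝕜 ≃ₐ[𝕜] MvPolynomial (Fin 2) 𝕜) (x₀ y₀ : 𝕜) (u m s : E → 𝕜),
        τ (X 0) = C x₀ * X 0 - C y₀ * X 1 ∧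
        τ (X 1) = C y₀ * X 0 + C x₀ * X 1 ∧
        (∀ e, u e ≠ 0) ∧
        (∀ e, τ (l' e) = C (u e) * affineSq 1 (m e) (s e)) ∧
        (∀ e, τ (l e) = C (u e) * affineSq 1 (m e) 0) ∧
        G.FaceTranslatable (fun e => affineSq 1 (m e) (s e)) ∧
        (∀ (d : ℕ) (p : V → MvPolynomial (Fin 2) 𝕜),
          (p ∈ G.splLE l' d ↔
            (fun v => τ (p v)) ∈ G.splLE (fun e => affineSq 1 (m e) (s e)) d) ∧
          (p ∈ G.splLE l d ↔
            (fun v => τ (p v)) ∈ G.splLE (fun e => affineSq 1 (m e) 0) d)))) ∧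
    (∀ [Algebra ℝ 𝕜] (Δ : PlanarTriangulation) (G : DirGraph Δ.Triangle Δ.dualGraph.edgeSet)
      (a b c : Δ.dualGraph.edgeSet → 𝕜)
      (l' l : Δ.dualGraph.edgeSet → MvPolynomial (Fin 2) 𝕜),
      Δ.IsDirectedDual G →
      (∀ e, a e ≠ 0 ∨ b e ≠ 0) →
      (∀ e, ∀ P : ℝ × ℝ, P ∈ (G.tail e).1 → P ∈ (G.head e).1 →
        a e * algebraMap ℝ 𝕜 P.1 + b e * algebraMap ℝ 𝕜 P.2 + c e = 0) →
      (∀ e, l' e = affineSq (a e) (b e) (c e)) →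
      (∀ e, l e = affineSq (a e) (b e) 0) →
      (∀ v₀ : Δ.Triangle,
        (∃ Ψ : G.splLEAt l' 2 v₀ ≃ₗ[𝕜] G.splHomAt l 2 v₀,
          ∀ p, G.cofactor l (Ψ p).1 = G.cofactor l' p.1) ∧
        G.splLEAt l 2 v₀ = G.splHomAt l 2 v₀) ∧
      Nonempty (G.splLE l' 2 ≃ₗ[𝕜] G.splLE l 2)) := by
  refine ⟨?_, ?_⟩
  · intro V E _ _ G a b c l' l hab hl' hl hG
    obtain rfl : l' = fun e => affineSq (a e) (b e) (c e) := funext hl'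
    obtain rfl : l = fun e => affineSq (a e) (b e) 0 := funext hl
    obtain ⟨hpointed, hiso⟩ := G.connected.exists_splLEAt_equiv_splHomAt
      (fun e => isLeadingForm_affineSq (hab e) (c e)) fun _ => hG.isExact_of_isExact_zero
    exact ⟨hG.cofactor_image_splLE h2 hab, hpointed, hiso, hG.exists_normal_form hab⟩
  · intro _ Δ G a b c l' l hG hab hline hl' hl
    obtain rfl : l' = fun e => affineSq (a e) (b e) (c e) := funext hl'
    obtain rfl : l = fun e => affineSq (a e) (b e) 0 := funext hl
    exact hG.isConnected.exists_splLEAt_equiv_splHomAt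
      (fun e => isLeadingForm_affineSq (hab e) (c e)) fun _ => hG.isExact_of_isExact_zero hline

theorem mainTheorem4 (𝕜 : Type*) [RCLike 𝕜] :
    -- face-translatable labelings `(a x + b y + c)²` of directed plane graphs
    (∀ (V E : Type*) [Fintype V] [Fintype E] (G : PlaneGraph V E) (a b c : E → 𝕜)
      (l' l : E → MvPolynomial (Fin 2) 𝕜),
      (∀ e, a e ≠ 0 ∨ b e ≠ 0) →
      (∀ e, l' e = affineSq (a e) (b e) (c e)) →
      (∀ e, l e = affineSq (a e) (b e) 0) →
      G.FaceTranslatable l' →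
      -- the cofactor map of `l'` maps onto the kernel of the extended cycle basis matrix
      (G.cofactor l' '' (G.splLE l' 2 : Set (V → MvPolynomial (Fin 2) 𝕜)) =
        {f | ∃ z : E → 𝕜, (G.extMatrix a b).mulVec z = 0 ∧ ∀ e, f e = MvPolynomial.C (z e)}) ∧
      -- the two spaces of splines are isomorphic through the cofactors
      (∀ v₀ : V,
        (∃ Ψ : G.splLEAt l' 2 v₀ ≃ₗ[𝕜] G.splHomAt l 2 v₀,
          ∀ p, G.cofactor l (Ψ p).1 = G.cofactor l' p.1) ∧
        G.splLEAt l 2 v₀ = G.splHomAt l 2 v₀) ∧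
      Nonempty (G.splLE l' 2 ≃ₗ[𝕜] G.splLE l 2) ∧
      -- an invertible change of variables brings all labels to the form `(x + m y + s)²`
      (∃ (τ : MvPolynomial (Fin 2) 𝕜 ≃ₐ[𝕜] MvPolynomial (Fin 2) 𝕜) (x₀ y₀ : 𝕜) (u m s : E → 𝕜),
        τ (MvPolynomial.X 0) =
          MvPolynomial.C x₀ * MvPolynomial.X 0 - MvPolynomial.C y₀ * MvPolynomial.X 1 ∧
        τ (MvPolynomial.X 1) =
          MvPolynomial.C y₀ * MvPolynomial.X 0 + MvPolynomial.C x₀ * MvPolynomial.X 1 ∧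
        (∀ e, u e ≠ 0) ∧
        (∀ e, τ (l' e) = MvPolynomial.C (u e) * affineSq 1 (m e) (s e)) ∧
        (∀ e, τ (l e) = MvPolynomial.C (u e) * affineSq 1 (m e) 0) ∧
        G.FaceTranslatable (fun e => affineSq 1 (m e) (s e)) ∧
        (∀ (d : ℕ) (p : V → MvPolynomial (Fin 2) 𝕜),
          (p ∈ G.splLE l' d ↔
            (fun v => τ (p v)) ∈ G.splLE (fun e => affineSq 1 (m e) (s e)) d) ∧
          (p ∈ G.splLE l d ↔
            (fun v => τ (p v)) ∈ G.splLE (fun e => affineSq 1 (m e) 0) d)))) ∧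
    -- dual graphs of planar triangulations, each edge labeled by the square of an equation of
    -- the line that carries the common edge of the two triangles
    (∀ (Δ : PlanarTriangulation) (G : DirGraph Δ.Triangle Δ.dualGraph.edgeSet)
      (a b c : Δ.dualGraph.edgeSet → 𝕜)
      (l' l : Δ.dualGraph.edgeSet → MvPolynomial (Fin 2) 𝕜),
      Δ.IsDirectedDual G →
      (∀ e, a e ≠ 0 ∨ b e ≠ 0) →
      (∀ e, ∀ P : ℝ × ℝ, P ∈ (G.tail e).1 → P ∈ (G.head e).1 →
        a e * (P.1 : 𝕜) + b e * (P.2 : 𝕜) + c e = 0) →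
      (∀ e, l' e = affineSq (a e) (b e) (c e)) →
      (∀ e, l e = affineSq (a e) (b e) 0) →
      (∀ v₀ : Δ.Triangle,
        (∃ Ψ : G.splLEAt l' 2 v₀ ≃ₗ[𝕜] G.splHomAt l 2 v₀,
          ∀ p, G.cofactor l (Ψ p).1 = G.cofactor l' p.1) ∧
        G.splLEAt l 2 v₀ = G.splHomAt l 2 v₀) ∧
      Nonempty (G.splLE l' 2 ≃ₗ[𝕜] G.splLE l 2)) :=
  let ⟨hplane, hdual⟩ := mainTheorem4_general 𝕜 two_ne_zero
  ⟨hplane, hdual⟩
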